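/- Let $T>0$ and let $f_0,\dots,f_m:\mathbb{R}^{n}\times\mathbb{R}^{l}\to\mathbb{R}^n$, $\varphi_0,\dots,\varphi_{d_\varphi}:\mathbb{R}^{2n}\to\mathbb{R}$ and $\eta_1,\dots,\eta_{d_\eta}:\mathbb{R}^{2n}\to\mathbb{R}$ be $C^2$ functions with Lipschitz-continuous second derivatives. Put $F(x,u,v)=f_0(x,u)+\sum_{i=1}^m v_i f_i(x,u)$ and consider the optimal control problem (P): minimize $\varphi_0(x_0,x_T)$ over $w=(x,u,v)\in W^{1,\infty}(0,T;\mathbb{R}^n)\times L^\infty(0,T;\mathbb{R}^l)\times L^\infty(0,T;\mathbb{R}^m)$ subject to $$\dot x_t=F(x_t,u_t,v_t)\ \text{ a.e. on }[0,T],\qquad \eta_j(x_0,x_T)=0\ (1\le j\le d_\eta),\qquad \varphi_i(x_0,x_T)\le 0\ (1\le i\le d_\varphi).$$ A feasible $\hat w=(\hat x,\hat u,\hat v)$ is a weak minimum if for some $\varepsilon>0$ it minimizes the cost among the feasible $w$ with $\|x-\hat x\|_\infty,\|u-\hat u\|_\infty,\|v-\hat v\|_\infty<\varepsilon$. For $\lambda=(\alpha,\beta,p)\in\mathbb{R}^{d_\varphi+1,*}\times\mathbb{R}^{d_\eta,*}\times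 W^{1,\infty}(0,T;\mathbb{R}^{n,*})$ set $H[\lambda](x,u,v,t)=p_tF(x,u,v)$ and $\ell[\lambda]=\sum_{i=0}^{d_\varphi}\alpha_i\varphi_i+\sum_{j=1}^{d_\eta}\beta_j\eta_j$. Suppose that all inequality constraints are active at $\hat w$, i.e. $\varphi_i(\hat x_0,\hat x_T)=0$ for $1\le i\le d_\varphi$. Then $\lambda$ is a Lagrange multiplier associated with $\hat w$ if $\sum_i|\alpha_i|+\sum_j|\beta_j|=1$, $\alpha\ge0$, $-\dot p_t=H_x[\lambda](\hat x_t,\hat u_t,\hat v_t,t)$ a.e. on $[0,T]$, $p_0=-D_{x_0}\ell[\lambda](\hat x_0,\hat x_T)$, $p_T=D_{x_T}\ell[\lambda](\hat x_0,\hat x_T)$, and $H_u[\lambda]=0$, $H_v[\lambda]=0$ along $\hat w$ a.e. on $[0,T]$. Claim (Legendre–Clebsch condition). If $\hat w$ is a weak minimum of (P), all of whose inequality constraints are active, and $\hat\lambda$ is its unique Lagrange multiplier, then for a.e. $t\in[0,T]$, along $\hat w$, the matrix $$D^2_{(u,v)^2}H[\hat\lambda]=\begin{pmatrix}H_{uu}[\hat\lambda]&H_{vu}[\hat\lambda]^\top\\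 H_{vu}[\hat\lambda]&0\end{pmatrix}$$ is positive semidefinite and, consequently, $H_{uu}[\hat\lambda]\succeq0$ and $H_{vu}[\hat\lambda]=0$. -/

import Mathlib

open MeasureTheory
open scoped ENNReal

noncomputable section

namespace PartiallyAffine

/-- The space `ℝᵏ` with its Euclidean norm. -/
abbrev E (k : ℕ) : Type := EuclideanSpace ℝ (Fin k)

/-- The dual space `ℝ^{k,*}` of row vectors. -/
abbrev EDual (k : ℕ) : Type := StrongDual ℝ (E k)

/-- The `i`-th vector of the canonical basis of `ℝᵏ`. -/
def e {k : ℕ} (i : Fin k) : E k := EuclideanSpace.single i (1 : ℝ)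

/-- The data of the problem: the horizon `T`, the vector fields `f₀, …, f_m`, the endpoint functions
`φ₀` (the cost) and `φ₁, …, φ_{dφ}` (inequality constraints), `η₁, …, η_{dη}` (equality
constraints). -/
structure Problem (n l m dφ dη : ℕ) where
  T : ℝ
  f : Fin (m + 1) → E n × E l → E n
  φ : Fin (dφ + 1) → E n × E n → ℝ
  η : Fin dη → E n × E n → ℝ

/-- `g` is twice continuously differentiable with Lipschitz continuous second derivative. -/
def LipschitzSecondDeriv {X Y : Type*} [NormedAddCommGroup X] [NormedSpace ℝ X]
    [NormedAddCommGroup Y] [NormedSpace ℝ Y] (g : X → Y) : Prop :=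
  ContDiff ℝ 2 g ∧ ∃ K, LipschitzWith K (fderiv ℝ (fderiv ℝ g))

/-- A triple `w = (x, u, v)` of state, nonlinear control and affine control. -/
structure StateControl (n l m : ℕ) where
  x : ℝ → E n
  u : ℝ → E l
  v : ℝ → E m

/-- A triple `lam = (α, β, p)`. -/
structure Triple (n dφ dη : ℕ) where
  α : Fin (dφ + 1) → ℝ
  β : Fin dη → ℝ
  p : ℝ → EDual n

/-- `h` (in its continuous representative on `[0,T]`) belongs to `W^{1,∞}(0,T;Y)`, i.e. it is
Lipschitz continuous on `[0,T]`. -/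
def MemW1inf {Y : Type*} [PseudoEMetricSpace Y] (T : ℝ) (h : ℝ → Y) : Prop :=
  ∃ K, LipschitzOnWith K h (Set.Icc 0 T)

/-- `h` belongs to `L^∞(0,T;Y)`. -/
def MemLinf {Y : Type*} [NormedAddCommGroup Y] (T : ℝ) (h : ℝ → Y) : Prop :=
  MemLp h ∞ (volume.restrict (Set.Icc 0 T))

/-- The `L^∞(0,T)` norm of `h`. -/
def normInf {Y : Type*} [NormedAddCommGroup Y] (T : ℝ) (h : ℝ → Y) : ℝ≥0∞ :=
  eLpNorm h ∞ (volume.restrict (Set.Icc 0 T))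

namespace Problem

variable {n l m dφ dη : ℕ}

/-- All data functions have Lipschitz continuous second derivatives. -/
def Regular (P : Problem n l m dφ dη) : Prop :=
  (∀ i, LipschitzSecondDeriv (P.f i)) ∧ (∀ i, LipschitzSecondDeriv (P.φ i)) ∧
    ∀ j, LipschitzSecondDeriv (P.η j)

/-- `F(x,u,v) = ∑_{i=0}^m v_i f_i(x,u)` with `v₀ = 1`. -/
def F (P : Problem n l m dφ dη) (x : E n) (u : E l) (v : E m) : E n :=
  ∑ i : Fin (m + 1), (Fin.cons 1 (fun k : Fin m => v k) : Fin (m + 1) → ℝ) i • P.f i (x, u)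

/-- The pair of endpoints `(x₀, x_T)`. -/
def endpoints (P : Problem n l m dφ dη) (w : StateControl n l m) : E n × E n := (w.x 0, w.x P.T)

/-- `w ∈ W^{1,∞} × L^∞ × L^∞` and the state equation holds a.e. on `[0,T]`. -/
structure IsTrajectory (P : Problem n l m dφ dη) (w : StateControl n l m) : Prop where
  memX : MemW1inf P.T w.x
  memU : MemLinf P.T w.u
  memV : MemLinf P.T w.v
  state : ∀ᵐ t ∂volume.restrict (Set.Icc 0 P.T),
    HasDerivAt w.x (P.F (w.x t) (w.u t) (w.v t)) t

/-- Feasible trajectories. -/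
structure IsFeasible (P : Problem n l m dφ dη) (w : StateControl n l m) : Prop
    extends P.IsTrajectory w where
  eq_constr : ∀ j, P.η j (P.endpoints w) = 0
  ineq_constr : ∀ i : Fin dφ, P.φ i.succ (P.endpoints w) ≤ 0

/-- Weak minima. -/
def IsWeakMin (P : Problem n l m dφ dη) (w : StateControl n l m) : Prop :=
  P.IsFeasible w ∧ ∃ ε : ℝ, 0 < ε ∧ ∀ w' : StateControl n l m, P.IsFeasible w' →
    normInf P.T (w'.x - w.x) < ENNReal.ofReal ε →
    normInf P.T (w'.u - w.u) < ENNReal.ofReal ε →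
    normInf P.T (w'.v - w.v) < ENNReal.ofReal ε →
    P.φ 0 (P.endpoints w) ≤ P.φ 0 (P.endpoints w')

/-- The pre-Hamiltonian `H[lam](x,u,v,t) = p_t ∑ v_i f_i(x,u)`. -/
def H (P : Problem n l m dφ dη) (lam : Triple n dφ dη) (x : E n) (u : E l) (v : E m) (t : ℝ) : ℝ :=
  lam.p t (P.F x u v)

/-- The endpoint Lagrangian. -/
def ell (P : Problem n l m dφ dη) (lam : Triple n dφ dη) (q : E n × E n) : ℝ :=
  ∑ i, lam.α i * P.φ i q + ∑ j, lam.β j * P.η j q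

/-- `lam` is a Lagrange multiplier associated with `w`, all inequality constraints being active
at `w`. -/
structure IsMultiplier (P : Problem n l m dφ dη) (w : StateControl n l m) (lam : Triple n dφ dη) :
    Prop where
  memP : MemW1inf P.T lam.p
  nontrivial : ∑ i, |lam.α i| + ∑ j, |lam.β j| = 1
  nonneg : ∀ i, 0 ≤ lam.α i
  costate : ∀ᵐ t ∂volume.restrict (Set.Icc 0 P.T),
    HasDerivAt lam.p (-fderiv ℝ (fun y => P.H lam y (w.u t) (w.v t) t) (w.x t)) t
  transv_zero : lam.p 0 = -fderiv ℝ (fun a => P.ell lam (a, w.x P.T)) (w.x 0)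
  transv_T : lam.p P.T = fderiv ℝ (fun b => P.ell lam (w.x 0, b)) (w.x P.T)
  stat_u : ∀ᵐ t ∂volume.restrict (Set.Icc 0 P.T),
    fderiv ℝ (fun a => P.H lam (w.x t) a (w.v t) t) (w.u t) = 0
  stat_v : ∀ᵐ t ∂volume.restrict (Set.Icc 0 P.T),
    fderiv ℝ (fun b => P.H lam (w.x t) (w.u t) b t) (w.v t) = 0

/-- `lam` is the unique multiplier associated with `w`; two costates are the same element of
`W^{1,∞}(0,T)` when they agree on `[0,T]`. -/
def IsUniqueMultiplier (P : Problem n l m dφ dη) (w : StateControl n l m) (lam : Triple n dφ dη) :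
    Prop :=
  P.IsMultiplier w lam ∧ ∀ lam', P.IsMultiplier w lam' →
    lam'.α = lam.α ∧ lam'.β = lam.β ∧ Set.EqOn lam'.p lam.p (Set.Icc 0 P.T)

/-- The matrix `H_uu[lam]` along `w` at time `t`. -/
def Huu (P : Problem n l m dφ dη) (w : StateControl n l m) (lam : Triple n dφ dη) (t : ℝ) :
    Matrix (Fin l) (Fin l) ℝ :=
  Matrix.of fun i j =>
    fderiv ℝ (fderiv ℝ fun a => P.H lam (w.x t) a (w.v t) t) (w.u t) (e i) (e j)

/-- The `m × l` matrix `H_vu[lam]` along `w` at time `t`: entry `(i,j)` is `∂²H/∂v_i∂u_j`. -/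
def Hvu (P : Problem n l m dφ dη) (w : StateControl n l m) (lam : Triple n dφ dη) (t : ℝ) :
    Matrix (Fin m) (Fin l) ℝ :=
  Matrix.of fun i j =>
    fderiv ℝ (fun b => fderiv ℝ (fun a => P.H lam (w.x t) a b t) (w.u t) (e j)) (w.v t) (e i)

/-- The Hessian matrix `D²_{(u,v)²} H[lam]` along `w` at time `t`, in the canonical basis of
`ℝˡ × ℝᵐ`. -/
def hessUV (P : Problem n l m dφ dη) (w : StateControl n l m) (lam : Triple n dφ dη) (t : ℝ) :
    Matrix (Fin l ⊕ Fin m) (Fin l ⊕ Fin m) ℝ :=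
  let basis : Fin l ⊕ Fin m → E l × E m := Sum.elim (fun i => (e i, 0)) (fun k => (0, e k))
  Matrix.of fun i j =>
    fderiv ℝ (fderiv ℝ fun z : E l × E m => P.H lam (w.x t) z.1 z.2 t) (w.u t, w.v t)
      (basis i) (basis j)

end Problem

end PartiallyAffine

end

set_option linter.unusedSectionVars false

/-! Suppose that for some direction `ξ` the form `p D²F (0,ξ)(0,ξ)` is negative on a set of times of
positive measure. A feasible trajectory, arbitrarily close to the reference and strictly cheaper, is
then constructed, which contradicts weak minimality.

Negative second variation. Take controls `ρ(t) ξ` with `ρ` a polynomial times the indicator of a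
short piece `S` of the bad set. The first variation of the endpoint map has finite-dimensional
values, so some nonzero polynomial is annihilated by it. The state response is of order `∫ |ρ|`,
whose square is at most `|S| ∫ ρ²`, so for short `S` the Legendre term, at most `-δ ∫ ρ²`, dominates
(`exists_secondVar_neg`).

Use of uniqueness. Let `R` be the range of the first variation of the map (cost excess, inequality
constraints; equality constraints). A functional that vanishes on `R` and is nonnegative on the
first block has a costate (`exists_costate`), so after normalization it is a Lagrange multiplier.
Uniqueness therefore says that `R` has a single normal ray, spanned by `Λ`. By Hahn–Banach, whenever
`Λ q < 0` some element of `R` moves `q` to a point with negative first block and zero second block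
(`IsUniqueNormal.exists_add_mem`).

Realization. Along `s` times the critical variation the endpoint map moves only to order `s²`, and
`Λ` of this displacement is at most `-δ s²`. A correction of size `O(s²)`, found by a contraction
argument, yields an exact trajectory with all equality constraints satisfied and the cost and all
inequality functions strictly decreased (`IsUniqueNormal.exists_solution`, `exists_improvement`).

Hence the form is nonnegative for almost every time. Since `F` is affine in `v`, its `vv` block
vanishes, and a positive semidefinite matrix with a zero diagonal block has zero off-diagonal blocks
next to it. -/

open Filter Topology Set in
theorem exists_fixedPoint_closedBall {X : Type*} [NormedAddCommGroup X] [CompleteSpace X]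
    (Ψ : X → X) {D : ℝ} (hD : 0 ≤ D)
    (hΨ : ∀ x y, ‖x‖ ≤ D → ‖y‖ ≤ D → ‖Ψ x - Ψ y‖ ≤ 1 / 2 * ‖x - y‖) (h0 : ‖Ψ 0‖ ≤ D / 2) :
    ∃ x, ‖x‖ ≤ D ∧ Ψ x = x := by
  have hmap : MapsTo Ψ (Metric.closedBall 0 D) (Metric.closedBall 0 D) := by
    intro x hx
    rw [mem_closedBall_zero_iff] at hx ⊢
    have h1 := hΨ x 0 hx (by simpa using hD)
    have h2 := norm_le_insert' (Ψ x) (Ψ 0)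
    rw [sub_zero] at h1
    linarith
  have hc : ContractingWith (1 / 2) (hmap.restrict Ψ _ _) := by
    refine ⟨by rw [← NNReal.coe_lt_coe]; norm_num, LipschitzWith.of_dist_le_mul fun x y => ?_⟩
    have := hΨ x y (mem_closedBall_zero_iff.1 x.2) (mem_closedBall_zero_iff.1 y.2)
    simpa [Subtype.dist_eq, dist_eq_norm] using this
  obtain ⟨y, hy, hfix, -⟩ := hc.exists_fixedPoint' Metric.isClosed_closedBall.isComplete hmap
    (x := 0) (by simpa using hD) (edist_ne_top _ _)
  exact ⟨y, by simpa using hy, hfix⟩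

/-! ### Separation from a unique normal, and solution of the perturbed endpoint system -/

section Separation

variable {ι V : Type*} [Fintype ι] [NormedAddCommGroup V] [NormedSpace ℝ V]
  [FiniteDimensional ℝ V]

/-- `Λ` is, up to a positive factor, the only nonzero functional that vanishes on `R` and is
nonnegative on the first factor. -/
def IsUniqueNormal [DecidableEq ι] (R : Submodule ℝ ((ι → ℝ) × V))
    (Λ : StrongDual ℝ ((ι → ℝ) × V)) : Prop :=
  ∀ f : StrongDual ℝ ((ι → ℝ) × V), f ≠ 0 → (∀ r ∈ R, f r = 0) →
    (∀ i, 0 ≤ f (Pi.single i 1, 0)) → ∃ c : ℝ, 0 < c ∧ f = c • Λ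

variable [DecidableEq ι] {R : Submodule ℝ ((ι → ℝ) × V)} {Λ : StrongDual ℝ ((ι → ℝ) × V)}

/-- Otherwise a nonzero functional of the second factor kills `R`. Both it and its negative vanish
on the first factor, so both are positive multiples of `Λ`, which forces `Λ = 0`. -/
theorem IsUniqueNormal.exists_snd_eq (hU : IsUniqueNormal R Λ) (v : V) : ∃ r ∈ R, r.2 = v := by
  have htop : R.map (LinearMap.snd ℝ (ι → ℝ) V) = ⊤ := by
    by_contra hne
    obtain ⟨f, hf, hker⟩ := Submodule.exists_le_ker_of_lt_top _ (lt_top_iff_ne_top.2 hne)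
    set g : StrongDual ℝ ((ι → ℝ) × V) :=
      (LinearMap.toContinuousLinearMap f).comp (ContinuousLinearMap.snd ℝ (ι → ℝ) V) with hg
    have hgne : g ≠ 0 := by
      intro h0
      apply hf
      ext x
      have := congrArg (fun k => k (0, x)) h0
      simpa [hg] using this
    have hgR : ∀ r ∈ R, g r = 0 := fun r hr => by
      have : r.2 ∈ R.map (LinearMap.snd ℝ (ι → ℝ) V) := ⟨r, hr, rfl⟩
      simpa [hg] using hker this
    obtain ⟨c, hc, h1⟩ := hU g hgne hgR (fun i => by simp [hg])
    obtain ⟨c', hc', h2⟩ := hU (-g) (neg_ne_zero.2 hgne) (fun r hr => by simp [hgR r hr])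
      (fun i => by simp [hg])
    have h3 : (c + c') • Λ = 0 := by rw [add_smul, ← h1, ← h2]; simp
    rcases smul_eq_zero.1 h3 with h | h
    · linarith
    · exact hgne (by rw [h1, h, smul_zero])
  have hv : v ∈ R.map (LinearMap.snd ℝ (ι → ℝ) V) := htop ▸ Submodule.mem_top
  obtain ⟨r, hr, h⟩ := hv
  exact ⟨r, hr, h⟩

theorem IsUniqueNormal.exists_rightInverse (hU : IsUniqueNormal R Λ) :
    ∃ ρ : V →L[ℝ] R, ∀ v, (ρ v : (ι → ℝ) × V).2 = v := by
  obtain ⟨g, hg⟩ := LinearMap.exists_rightInverse_of_surjective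
    ((LinearMap.snd ℝ (ι → ℝ) V).comp R.subtype) (LinearMap.range_eq_top.2 fun v => by
      obtain ⟨r, hr, h⟩ := hU.exists_snd_eq v
      exact ⟨⟨r, hr⟩, h⟩)
  exact ⟨LinearMap.toContinuousLinearMap g, fun v => by simpa using LinearMap.congr_fun hg v⟩

-- If `q` cannot be corrected, Hahn–Banach separates it from `R` minus the open positive orthant.
-- The separating functional is a normal, hence a positive multiple of `Λ`, and it is nonnegative at
-- `q`.
open Filter Topology Set in
theorem IsUniqueNormal.exists_add_mem [Nonempty ι] (hU : IsUniqueNormal R Λ)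
    {q : (ι → ℝ) × V} (hq : Λ q < 0) :
    ∃ r ∈ R, (∀ i, (q + r).1 i < 0) ∧ (q + r).2 = 0 := by
  obtain ⟨ρ, hρ⟩ := hU.exists_rightInverse
  set S : Set ((ι → ℝ) × V) := {y | ∃ r ∈ R, y.2 = r.2 ∧ ∀ i, y.1 i < r.1 i} with hS
  have hSo : IsOpen S := by
    -- Openness in the `V` direction comes from the bounded right inverse: `ρ y.2` follows `y`
    -- inside `R`, leaving only strict continuous inequalities.
    have : S = ⋃ r ∈ {r ∈ (R : Set ((ι → ℝ) × V)) | r.2 = 0},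
        {y | ∀ i, y.1 i < (ρ y.2 : (ι → ℝ) × V).1 i + r.1 i} := by
      ext y
      simp only [hS, mem_ofPred_eq, mem_iUnion, exists_prop, SetLike.mem_coe]
      constructor
      · rintro ⟨r, hr, h2, h1⟩
        refine ⟨r - ρ y.2, ⟨R.sub_mem hr (ρ y.2).2, ?_⟩, fun i => ?_⟩
        · simp [hρ, h2]
        · simpa using h1 i
      · rintro ⟨r, ⟨hr, h2⟩, h1⟩
        exact ⟨ρ y.2 + r, R.add_mem (ρ y.2).2 hr, by simp [hρ, h2], fun i => by simpa using h1 i⟩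
    rw [this]
    refine isOpen_biUnion fun r _ => ?_
    rw [ofPred_forall]
    exact isOpen_iInter_of_finite fun i => isOpen_lt (by fun_prop) (by fun_prop)
  have hSc : Convex ℝ S := by
    rintro y ⟨r, hr, h2, h1⟩ y' ⟨r', hr', h2', h1'⟩ a b ha hb hab
    refine ⟨a • r + b • r', R.add_mem (R.smul_mem _ hr) (R.smul_mem _ hr'), by simp [h2, h2'],
      fun i => ?_⟩
    have e1 := h1 i
    have e2 := h1' i
    simp only [Prod.fst_add, Prod.smul_fst, Pi.add_apply, Pi.smul_apply, smul_eq_mul]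
    rcases ha.eq_or_lt with rfl | ha
    · simp_all
    · have := mul_lt_mul_of_pos_left e1 ha
      have := mul_le_mul_of_nonneg_left e2.le hb
      linarith
  by_cases hqS : q ∈ S
  · obtain ⟨r, hr, h2, h1⟩ := hqS
    exact ⟨-r, R.neg_mem hr, fun i => by simpa using h1 i, by simp [h2]⟩
  exfalso
  obtain ⟨f, hf⟩ := geometric_hahn_banach_open_point hSc hSo hqS
  set n : (ι → ℝ) × V := (fun _ => -1, 0) with hn
  -- The test points `u n + r - t eᵢ` lie in `S`. Letting `r`, `t` and `u` vary separately gives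
  -- vanishing on `R`, nonnegativity on `eᵢ`, and `0 ≤ f q`.
  have hkey : ∀ r ∈ R, ∀ i, ∀ t : ℝ, 0 ≤ t → ∀ u : ℝ, 0 < u →
      u * f n + f r - t * f (Pi.single i 1, 0) < f q := by
    intro r hr i t ht u hu
    have := hf (u • n + r - t • ((Pi.single i 1, 0) : (ι → ℝ) × V)) ⟨r, hr, by simp [hn], fun j => by
      have : 0 ≤ t * (Pi.single i 1 : ι → ℝ) j := by
        refine mul_nonneg ht ?_
        rw [Pi.single_apply]; split_ifs <;> norm_num
      simp [hn]; linarith⟩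
    rwa [map_sub, map_add, map_smul, map_smul, smul_eq_mul, smul_eq_mul] at this
  obtain ⟨i0⟩ := ‹Nonempty ι›
  have hR : ∀ r ∈ R, f r = 0 := by
    intro r hr
    by_contra hne
    have := hkey (((f q - f n) / f r) • r) (R.smul_mem _ hr) i0 0 le_rfl 1 one_pos
    rw [map_smul, smul_eq_mul, div_mul_cancel₀ _ hne] at this
    linarith
  have hpos : ∀ i, 0 ≤ f (Pi.single i 1, 0) := by
    intro i
    by_contra hneg
    push Not at hneg
    have h1 := hkey 0 R.zero_mem i0 0 le_rfl 1 one_pos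
    simp only [map_zero] at h1
    have := hkey 0 R.zero_mem i ((f q - f n) / -f (Pi.single i 1, 0))
      (div_nonneg (by linarith) (by linarith)) 1 one_pos
    have e : (f q - f n) / -f (Pi.single i 1, 0) * f (Pi.single i 1, 0) = -(f q - f n) := by
      rw [div_neg, neg_mul, div_mul_cancel₀ _ hneg.ne]
    rw [e, map_zero] at this
    linarith
  have hq0 : 0 ≤ f q := by
    have h1 : ∀ u : ℝ, 0 < u → u * f n < f q := fun u hu => by
      simpa using hkey 0 R.zero_mem i0 0 le_rfl u hu
    by_contra hneg
    push Not at hneg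
    have hfn : f n < 0 := by have := h1 1 one_pos; linarith
    have := h1 (f q / f n) (div_pos_of_neg_of_neg hneg hfn)
    rw [div_mul_cancel₀ _ hfn.ne] at this
    exact lt_irrefl _ this
  have hne : f ≠ 0 := by
    rintro rfl
    simpa using hkey 0 R.zero_mem i0 0 le_rfl 1 one_pos
  obtain ⟨c, hc, h⟩ := hU f hne hR hpos
  rw [h] at hq0
  have : c * Λ q < 0 := mul_neg_of_pos_of_neg hc hq
  simp at hq0
  linarith

-- The unknown is `τ = (r, z)`: a first-order endpoint displacement `r ∈ R` and an integrated
-- dynamics remainder `z`. The maps `E₁`, `E₂` are the remainders of the dynamics and of the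
-- endpoint map. They are of size `s²` at `0` and have Lipschitz constant `O(s)` on the ball of
-- radius `s`, so corrections of size `s²` suffice.
open Filter Topology Set in
theorem IsUniqueNormal.exists_solution [Nonempty ι] {X : Type*} [NormedAddCommGroup X]
    [CompleteSpace X] (hU : IsUniqueNormal R Λ)
    (E₁ : ℝ → R × X → X) (E₂ : ℝ → R × X → (ι → ℝ) × V) {C s₀ δ : ℝ} (hC : 0 ≤ C) (hs₀ : 0 < s₀)
    (hδ : 0 < δ)
    (h₁ : ∀ s, 0 < s → s < s₀ → ∀ τ τ', ‖τ‖ ≤ s → ‖τ'‖ ≤ s →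
      ‖E₁ s τ - E₁ s τ'‖ ≤ C * s * ‖τ - τ'‖)
    (h₂ : ∀ s, 0 < s → s < s₀ → ∀ τ τ', ‖τ‖ ≤ s → ‖τ'‖ ≤ s →
      ‖E₂ s τ - E₂ s τ'‖ ≤ C * s * ‖τ - τ'‖)
    (h₁0 : ∀ s, 0 < s → s < s₀ → ‖E₁ s 0‖ ≤ C * s ^ 2)
    (h₂0 : ∀ s, 0 < s → s < s₀ → ‖E₂ s 0‖ ≤ C * s ^ 2)
    (hΛ : ∀ s, 0 < s → s < s₀ → Λ (E₂ s 0) ≤ -δ * s ^ 2) {ε : ℝ} (hε : 0 < ε) :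
    ∃ s, 0 < s ∧ s < ε ∧ ∃ τ, ‖τ‖ ≤ s ∧ τ.2 = E₁ s τ ∧
      (∀ i, ((τ.1 : (ι → ℝ) × V) + E₂ s τ).1 i < 0) ∧
      ((τ.1 : (ι → ℝ) × V) + E₂ s τ).2 = 0 := by
  obtain ⟨ρ, hρ⟩ := hU.exists_rightInverse
  -- The quotient `E₂ s 0 / s²` is bounded but need not converge; along an ultrafilter it has a
  -- limit `q₀`, with `Λ q₀ ≤ -δ`.
  set U : Ultrafilter ℝ := Ultrafilter.of (𝓝[>] (0 : ℝ))
  have hUle : (U : Filter ℝ) ≤ 𝓝[>] 0 := Ultrafilter.of_le _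
  set q : ℝ → (ι → ℝ) × V := fun s => (s ^ 2)⁻¹ • E₂ s 0 with hq
  have hev : ∀ a : ℝ, 0 < a → ∀ᶠ s in (U : Filter ℝ), 0 < s ∧ s < a := fun a ha =>
    hUle (Ioo_mem_nhdsGT ha)
  have hqb : ∀ᶠ s in (U : Filter ℝ), q s ∈ Metric.closedBall (0 : (ι → ℝ) × V) C := by
    filter_upwards [hev s₀ hs₀] with s hs
    have hs2 : 0 < s ^ 2 := pow_pos hs.1 2
    rw [mem_closedBall_zero_iff, hq, norm_smul, norm_inv, Real.norm_of_nonneg hs2.le,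
      inv_mul_le_iff₀ hs2, mul_comm]
    exact h₂0 s hs.1 hs.2
  obtain ⟨q₀, -, hq₀⟩ := (isCompact_closedBall (0 : (ι → ℝ) × V) C).ultrafilter_le_nhds
    (U.map q) (Filter.le_principal_iff.2 hqb)
  have hq₀ : Tendsto q U (𝓝 q₀) := hq₀
  have hΛq : Λ q₀ < 0 := by
    have : Λ q₀ ≤ -δ := by
      refine le_of_tendsto ((Λ.continuous.tendsto _).comp hq₀) ?_
      filter_upwards [hev s₀ hs₀] with s hs
      have hs2 : 0 < s ^ 2 := pow_pos hs.1 2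
      simp only [Function.comp, hq, map_smul, smul_eq_mul]
      rw [inv_mul_le_iff₀ hs2]
      linarith [hΛ s hs.1 hs.2]
    linarith
  obtain ⟨k, hk, hk1, hk2⟩ := hU.exists_add_mem hΛq
  obtain ⟨m, hm, hkm⟩ : ∃ m : ℝ, 0 < m ∧ ∀ i, (q₀ + k).1 i ≤ -m := by
    obtain ⟨i, hi⟩ := Finite.exists_max (fun i => (q₀ + k).1 i)
    exact ⟨-(q₀ + k).1 i, neg_pos.2 (hk1 i), fun j => by rw [neg_neg]; exact hi j⟩
  set k' : R := ⟨k, hk⟩ with hk'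
  have hk'n : ‖k'‖ = ‖k‖ := rfl
  -- Since `‖Ψ 0‖ ≤ (2‖k‖ + C) s²` below, `D` is twice this constant, as the fixed point lemma
  -- requires. On the ball of radius `D s²`, `G s²` bounds `‖τ σ‖`.
  set D : ℝ := 2 * (2 * ‖k‖ + C) with hD
  set G : ℝ := ‖k‖ + (‖ρ‖ + 1) * D with hG
  have hD0 : 0 ≤ D := by positivity
  have hG0 : 0 ≤ G := by positivity
  have hsmall : ∀ A : ℝ, 0 ≤ A → ∀ᶠ s in (U : Filter ℝ), A * s ≤ 1 := by
    intro A hA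
    filter_upwards [hev (1 / (A + 1)) (by positivity)] with s hs
    have := hs.2
    rw [lt_div_iff₀ (by positivity)] at this
    nlinarith [hs.1]
  have hlim : ∀ᶠ s in (U : Filter ℝ), (1 + ‖ρ‖) * (‖q s - q₀‖ + C * G * s) < m := by
    have hid : Tendsto (fun s : ℝ => s) U (𝓝 0) :=
      (tendsto_id.mono_left nhdsWithin_le_nhds).mono_left hUle
    have : Tendsto (fun s => (1 + ‖ρ‖) * (‖q s - q₀‖ + C * G * s)) U
        (𝓝 ((1 + ‖ρ‖) * (‖q₀ - q₀‖ + C * G * 0))) :=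
      ((hq₀.sub_const q₀).norm.add (hid.const_mul _)).const_mul _
    rw [sub_self, norm_zero, mul_zero, add_zero, mul_zero] at this
    exact this.eventually_lt_const hm
  obtain ⟨s, ⟨hs, hse⟩, ⟨-, hss⟩, hs1, hs2, hs3, hs4⟩ := ((hev ε hε).and ((hev s₀ hs₀).and
    ((hsmall G hG0).and ((hsmall C hC).and
      ((hsmall (2 * C * (‖ρ‖ + 1)) (by positivity)).and hlim))))).exists
  have hs2p : 0 < s ^ 2 := pow_pos hs 2
  -- Ansatz: `s² k` produces the decrease predicted at `q₀`, while `ρ σ.1` is free to restore the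
  -- equality constraints.
  set τ : V × X → R × X := fun σ => (s ^ 2 • k' + ρ σ.1, σ.2) with hτ
  have hτd : ∀ σ σ', ‖τ σ - τ σ'‖ ≤ (‖ρ‖ + 1) * ‖σ - σ'‖ := by
    intro σ σ'
    have e : τ σ - τ σ' = (ρ (σ - σ').1, (σ - σ').2) := by
      simp [hτ]
    rw [e, Prod.norm_mk]
    refine max_le ?_ ?_
    · calc ‖ρ (σ - σ').1‖ ≤ ‖ρ‖ * ‖(σ - σ').1‖ := ρ.le_opNorm _
        _ ≤ (‖ρ‖ + 1) * ‖σ - σ'‖ := by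
          gcongr
          · linarith
          · exact norm_fst_le _
    · calc ‖(σ - σ').2‖ ≤ 1 * ‖σ - σ'‖ := by rw [one_mul]; exact norm_snd_le _
        _ ≤ _ := by gcongr; linarith [norm_nonneg ρ]
  have hτ0 : ‖τ 0‖ ≤ s ^ 2 * ‖k‖ := by
    simp [hτ, Prod.norm_mk, norm_smul, hk'n, abs_of_pos hs]
    positivity
  have hτG : ∀ σ, ‖σ‖ ≤ D * s ^ 2 → ‖τ σ‖ ≤ G * s ^ 2 := by
    intro σ hσ
    have h1 := hτd σ 0
    rw [sub_zero] at h1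
    have h2 := norm_le_insert' (τ σ) (τ 0)
    have h3 : (‖ρ‖ + 1) * ‖σ‖ ≤ (‖ρ‖ + 1) * (D * s ^ 2) := by gcongr
    calc _ ≤ _ := h2
      _ ≤ s ^ 2 * ‖k‖ + (‖ρ‖ + 1) * (D * s ^ 2) := by linarith
      _ = _ := by rw [hG]; ring
  have hGs : G * s ^ 2 ≤ s := by nlinarith
  -- As `ρ` is a right inverse of the second projection, a fixed point of `Ψ` solves exactly the `V`
  -- equation and `z = E₁ s τ`.
  set Ψ : V × X → V × X := fun σ => (-(s ^ 2 • k + E₂ s (τ σ)).2, E₁ s (τ σ)) with hΨ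
  obtain ⟨σ, hσ, hfix⟩ := exists_fixedPoint_closedBall Ψ (D := D * s ^ 2) (by positivity)
    (fun σ σ' hσ hσ' => by
      have hb := (hτG σ hσ).trans hGs
      have hb' := (hτG σ' hσ').trans hGs
      have hl : C * s * ‖τ σ - τ σ'‖ ≤ 1 / 2 * ‖σ - σ'‖ := by
        calc C * s * ‖τ σ - τ σ'‖ ≤ C * s * ((‖ρ‖ + 1) * ‖σ - σ'‖) := by
              gcongr; exact hτd σ σ'
          _ = (2 * C * (‖ρ‖ + 1) * s) * (1 / 2 * ‖σ - σ'‖) := by ring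
          _ ≤ 1 * (1 / 2 * ‖σ - σ'‖) := by gcongr
          _ = _ := one_mul _
      have e : Ψ σ - Ψ σ' = ((E₂ s (τ σ') - E₂ s (τ σ)).2, E₁ s (τ σ) - E₁ s (τ σ')) := by
        simp [hΨ]; abel
      rw [e, Prod.norm_mk]
      refine max_le ?_ ((h₁ s hs hss _ _ hb hb').trans hl)
      refine (norm_snd_le _).trans ?_
      rw [norm_sub_rev]
      exact (h₂ s hs hss _ _ hb hb').trans hl)
    (by
      have h0 : ‖τ 0‖ ≤ s := (hτG 0 (by rw [norm_zero]; positivity)).trans hGs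
      have hz : ‖(0 : R × X)‖ ≤ s := by rw [norm_zero]; exact hs.le
      have hCs : C * s * ‖τ 0‖ ≤ s ^ 2 * ‖k‖ :=
        (mul_le_mul hs2 hτ0 (norm_nonneg _) one_pos.le).trans (one_mul _).le
      have a1 := h₁ s hs hss (τ 0) 0 h0 hz
      have a2 := h₂ s hs hss (τ 0) 0 h0 hz
      rw [sub_zero] at a1 a2
      have b1 := norm_le_insert' (E₁ s (τ 0)) (E₁ s 0)
      have b2 := norm_le_insert' (E₂ s (τ 0)) (E₂ s 0)
      have c1 := h₁0 s hs hss
      have c2 := h₂0 s hs hss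
      have hkk : 0 ≤ s ^ 2 * ‖k‖ := by positivity
      rw [show D * s ^ 2 / 2 = 2 * (s ^ 2 * ‖k‖) + C * s ^ 2 by rw [hD]; ring]
      simp only [hΨ, Prod.norm_mk]
      refine max_le ?_ (by linarith)
      rw [norm_neg]
      refine (norm_snd_le _).trans ((norm_add_le _ _).trans ?_)
      rw [norm_smul, Real.norm_of_nonneg hs2p.le]
      linarith)
  have hτσ := hτG σ hσ
  have f1 : -(s ^ 2 • k + E₂ s (τ σ)).2 = σ.1 := congrArg Prod.fst hfix
  have f2 : E₁ s (τ σ) = σ.2 := congrArg Prod.snd hfix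
  have hsum : (((τ σ).1 : R) : (ι → ℝ) × V) = s ^ 2 • k + ρ σ.1 := rfl
  have hdiff : ‖E₂ s (τ σ) - E₂ s 0‖ ≤ s ^ 2 * (C * G * s) := by
    have := h₂ s hs hss (τ σ) 0 (hτσ.trans hGs) (by rw [norm_zero]; exact hs.le)
    rw [sub_zero] at this
    calc _ ≤ _ := this
      _ ≤ C * s * (G * s ^ 2) := by gcongr
      _ = _ := by ring
  have hE20 : E₂ s 0 = s ^ 2 • q s := by simp [hq, smul_smul, hs.ne']
  set err := s ^ 2 • (q s - q₀) + (E₂ s (τ σ) - E₂ s 0) with herr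
  have herrn : ‖err‖ ≤ s ^ 2 * (‖q s - q₀‖ + C * G * s) := by
    refine (norm_add_le _ _).trans ?_
    rw [norm_smul, Real.norm_of_nonneg hs2p.le, mul_add]
    linarith
  have hdec : s ^ 2 • k + E₂ s (τ σ) = s ^ 2 • (q₀ + k) + err := by
    rw [herr, hE20]
    simp only [smul_add, smul_sub]
    abel
  -- Because `(q₀ + k).2 = 0`, the equality correction is no larger than `err`; its effect on the
  -- inequalities is therefore below the margin `s² m`.
  have hb : ‖σ.1‖ ≤ ‖err‖ := by
    rw [← f1, hdec, norm_neg, Prod.snd_add, Prod.smul_snd, hk2, smul_zero, zero_add]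
    exact norm_snd_le _
  refine ⟨s, hs, hse, τ σ, hτσ.trans hGs, f2.symm, fun i => ?_, ?_⟩
  · have hv : (((τ σ).1 : R) : (ι → ℝ) × V) + E₂ s (τ σ)
        = s ^ 2 • (q₀ + k) + (err + ρ σ.1) := by
      rw [hsum, ← add_assoc, ← hdec]; abel
    have hn : ‖err + ρ σ.1‖ ≤ s ^ 2 * ((1 + ‖ρ‖) * (‖q s - q₀‖ + C * G * s)) := by
      calc ‖err + ρ σ.1‖ ≤ ‖err‖ + ‖ρ‖ * ‖σ.1‖ := (norm_add_le _ _).trans (by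
            gcongr; exact ρ.le_opNorm _)
        _ ≤ ‖err‖ + ‖ρ‖ * ‖err‖ := by gcongr
        _ = (1 + ‖ρ‖) * ‖err‖ := by ring
        _ ≤ (1 + ‖ρ‖) * (s ^ 2 * (‖q s - q₀‖ + C * G * s)) := by gcongr
        _ = _ := by ring
    have hi : (err + ρ σ.1).1 i ≤ ‖err + ρ σ.1‖ :=
      (le_abs_self _).trans ((norm_le_pi_norm (err + ρ σ.1).1 i).trans (norm_fst_le _))
    have h3 : s ^ 2 * ((1 + ‖ρ‖) * (‖q s - q₀‖ + C * G * s)) < s ^ 2 * m := by gcongr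
    have h4 : s ^ 2 * (q₀ + k).1 i ≤ s ^ 2 * -m := by gcongr; exact hkm i
    rw [hv]
    have : (s ^ 2 • (q₀ + k) + (err + ρ σ.1)).1 i = s ^ 2 * (q₀ + k).1 i + (err + ρ σ.1).1 i := rfl
    rw [this]
    linarith
  · rw [hsum, Prod.snd_add, Prod.snd_add, hρ, ← f1]
    simp

end Separation

/-! ### Taylor remainders, uniform in the base point -/

section Taylor

variable {Z W : Type*} [NormedAddCommGroup Z] [NormedSpace ℝ Z]
  [NormedAddCommGroup W] [NormedSpace ℝ W]

/-- The remainder of the first order Taylor expansion of `G` at `b`. -/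
noncomputable def taylorRem (G : Z → W) (b d : Z) : W := G (b + d) - G b - fderiv ℝ G b d

@[simp] theorem taylorRem_zero (G : Z → W) (b : Z) : taylorRem G b 0 = 0 := by simp [taylorRem]

theorem continuous_taylorRem {G : Z → W} (hG : ContDiff ℝ 2 G) :
    Continuous fun q : Z × Z => taylorRem G q.1 q.2 := by
  have h1 := hG.continuous
  have h2 : Continuous (fderiv ℝ G) := hG.continuous_fderiv (by norm_num)
  unfold taylorRem
  fun_prop

variable [ProperSpace Z]

/-- The remainder has derivative `DG(b + x) - DG(b)`, of norm at most `K r` on the ball of radius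
`r`. The factor `r` is what makes the later fixed point maps contractions. -/
theorem exists_norm_taylorRem_sub_le {G : Z → W} (hG : ContDiff ℝ 2 G) (M : ℝ) :
    ∃ K : ℝ, 0 ≤ K ∧ ∀ b, ‖b‖ ≤ M → ∀ r, r ≤ 1 → ∀ d d', ‖d‖ ≤ r → ‖d'‖ ≤ r →
      ‖taylorRem G b d - taylorRem G b d'‖ ≤ K * r * ‖d - d'‖ := by
  have h1 : ContDiff ℝ 1 (fderiv ℝ G) := hG.fderiv_right (by norm_num)
  obtain ⟨K, hK⟩ := h1.contDiffOn.exists_lipschitzOnWith one_ne_zero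
    (convex_closedBall (0 : Z) (M + 1)) (isCompact_closedBall _ _)
  refine ⟨K, K.2, fun b hb r hr d d' hd hd' => ?_⟩
  have hball : ∀ x, ‖x‖ ≤ r → b + x ∈ Metric.closedBall (0 : Z) (M + 1) := fun x hx => by
    rw [mem_closedBall_zero_iff]
    exact (norm_add_le _ _).trans (by linarith)
  have hr0 : 0 ≤ r := (norm_nonneg d).trans hd
  have key := (convex_closedBall (0 : Z) r).norm_image_sub_le_of_norm_hasFDerivWithin_le'
    (f := fun x => G (b + x)) (f' := fun x => fderiv ℝ G (b + x)) (φ := fderiv ℝ G b)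
    (C := K * r) (x := d') (y := d) (fun x _ => by
      have : HasFDerivAt G (fderiv ℝ G (b + x)) (b + x) :=
        (hG.differentiable (by norm_num) _).hasFDerivAt
      exact ((hasFDerivAt_comp_add_left b).2 this).hasFDerivWithinAt)
    (fun x hx => by
      rw [mem_closedBall_zero_iff] at hx
      have := hK.dist_le_mul _ (hball x hx) b (by simpa using hball 0 (by simpa using hr0))
      rw [dist_eq_norm, dist_eq_norm, add_sub_cancel_left] at this
      exact this.trans (by gcongr))
    (by simpa using hd') (by simpa using hd)
  convert key using 2
  simp only [taylorRem, map_sub]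
  abel

/-- Uniform continuity of `D²G` on a compact ball and two uses of the mean value inequality, first
for `DG`, then for `G` minus its quadratic model. Symmetry of `D²G(b)` identifies the derivative of
the quadratic term. -/
theorem exists_norm_taylorRem_sub_half_le {G : Z → W} (hG : ContDiff ℝ 2 G) (M : ℝ) {ε : ℝ}
    (hε : 0 < ε) :
    ∃ δ : ℝ, 0 < δ ∧ ∀ b, ‖b‖ ≤ M → ∀ d, ‖d‖ ≤ δ →
      ‖taylorRem G b d - (1 / 2 : ℝ) • fderiv ℝ (fderiv ℝ G) b d d‖ ≤ ε * ‖d‖ ^ 2 := by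
  have h1 : ContDiff ℝ 1 (fderiv ℝ G) := hG.fderiv_right (by norm_num)
  have h2 : Continuous (fderiv ℝ (fderiv ℝ G)) := h1.continuous_fderiv (by norm_num)
  have huc : UniformContinuousOn (fun x => fderiv ℝ (fderiv ℝ G) x) _ := (isCompact_closedBall (0 : Z) (M + 1)).uniformContinuousOn_of_continuous
    h2.continuousOn
  obtain ⟨δ, hδ, hu⟩ := (Metric.uniformContinuousOn_iff (α := Z) (β := Z →L[ℝ] Z →L[ℝ] W)).1 huc ε hε
  refine ⟨min 1 (δ / 2), by positivity, fun b hb d hd => ?_⟩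
  have hd1 : ‖d‖ ≤ 1 := hd.trans (min_le_left _ _)
  have hdδ : ‖d‖ < δ := (hd.trans (min_le_right _ _)).trans_lt (by linarith)
  have hball : ∀ x, ‖x‖ ≤ ‖d‖ → b + x ∈ Metric.closedBall (0 : Z) (M + 1) := fun x hx => by
    rw [mem_closedBall_zero_iff]
    exact (norm_add_le _ _).trans (by linarith)
  set B := fderiv ℝ (fderiv ℝ G) b with hB
  have hsymm : ∀ v w, B v w = B w v :=
    fun v w => (hG.contDiffAt.isSymmSndFDerivAt (by simp)) v w
  have hfirst : ∀ x, ‖x‖ ≤ ‖d‖ → ‖fderiv ℝ G (b + x) - fderiv ℝ G b - B x‖ ≤ ε * ‖d‖ := by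
    intro x hx
    have key := (convex_closedBall (0 : Z) ‖d‖).norm_image_sub_le_of_norm_hasFDerivWithin_le'
      (f := fun x => fderiv ℝ G (b + x)) (f' := fun x => fderiv ℝ (fderiv ℝ G) (b + x)) (φ := B)
      (C := ε) (x := 0) (y := x) (fun y _ => by
        have : HasFDerivAt (fderiv ℝ G) (fderiv ℝ (fderiv ℝ G) (b + y)) (b + y) :=
          (h1.differentiable (by norm_num) _).hasFDerivAt
        exact ((hasFDerivAt_comp_add_left b).2 this).hasFDerivWithinAt)
      (fun y hy => by
        rw [mem_closedBall_zero_iff] at hy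
        have := hu _ (hball y hy) b (by simpa using hball 0 (by simp)) (by
          rw [dist_eq_norm, add_sub_cancel_left]; linarith)
        exact le_of_eq_of_le (dist_eq_norm (fderiv ℝ (fderiv ℝ G) (b + y)) B).symm this.le)
      (by simp) (by simpa using hx)
    simp only [add_zero, sub_zero] at key
    exact key.trans (by gcongr)
  have key := (convex_closedBall (0 : Z) ‖d‖).norm_image_sub_le_of_norm_hasFDerivWithin_le
    (f := fun x => G (b + x) - fderiv ℝ G b x - (1 / 2 : ℝ) • B x x)
    (f' := fun x => fderiv ℝ G (b + x) - fderiv ℝ G b - B x)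
    (C := ε * ‖d‖) (x := 0) (y := d) (fun x _ => by
      have e1 : HasFDerivAt G (fderiv ℝ G (b + x)) (b + x) :=
        (hG.differentiable (by norm_num) _).hasFDerivAt
      have e2 : HasFDerivAt (fun x => B x x) (B x + B.flip x) x := by
        have := B.hasFDerivAt.clm_apply (hasFDerivAt_id x)
        convert! this using 1
      have := (((hasFDerivAt_comp_add_left b).2 e1).sub (fderiv ℝ G b).hasFDerivAt).sub
        (e2.const_smul (1 / 2 : ℝ))
      refine HasFDerivAt.hasFDerivWithinAt ?_
      convert! this using 1
      ext v
      simp only [sub_apply, smul_apply,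
        add_apply, ContinuousLinearMap.flip_apply, hsymm v x, ← two_smul ℝ,
        smul_smul]
      norm_num)
    (fun x hx => hfirst x (by simpa using hx)) (by simp) (by simp)
  simp only [add_zero, map_zero, sub_zero, smul_zero] at key
  calc _ = ‖G (b + d) - fderiv ℝ G b d - (1 / 2 : ℝ) • B d d - G b‖ := by
        rw [taylorRem]; congr 1; abel
    _ ≤ _ := key
    _ = _ := by ring

end Taylor

/-! ### Bounded measurable functions, primitives and Lipschitz functions on `[0,T]` -/

section Primitive

variable {W W' : Type*} [NormedAddCommGroup W] [NormedSpace ℝ W]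
  [NormedAddCommGroup W'] [NormedSpace ℝ W']

/-- Lebesgue measure on `[0,T]`. -/
noncomputable abbrev timeMeasure (T : ℝ) : Measure ℝ := volume.restrict (Set.Icc 0 T)

/-- Bounded strongly measurable functions of time. -/
def BddMeas (f : ℝ → W) : Prop := StronglyMeasurable f ∧ ∃ M, ∀ t, ‖f t‖ ≤ M

namespace BddMeas

theorem const (c : W) : BddMeas fun _ => c := ⟨stronglyMeasurable_const, ‖c‖, fun _ => le_rfl⟩

theorem add {f g : ℝ → W} (hf : BddMeas f) (hg : BddMeas g) : BddMeas fun t => f t + g t := by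
  obtain ⟨hf, M, hM⟩ := hf
  obtain ⟨hg, N, hN⟩ := hg
  exact ⟨hf.add hg, M + N, fun t => (norm_add_le _ _).trans (add_le_add (hM t) (hN t))⟩

theorem const_smul {f : ℝ → W} (hf : BddMeas f) (c : ℝ) : BddMeas fun t => c • f t := by
  obtain ⟨hf, M, hM⟩ := hf
  exact ⟨hf.const_smul c, ‖c‖ * M, fun t => by rw [norm_smul]; gcongr; exact hM t⟩

theorem neg {f : ℝ → W} (hf : BddMeas f) : BddMeas fun t => -f t := by
  simpa using hf.const_smul (-1)

theorem prodMk {f : ℝ → W} {g : ℝ → W'} (hf : BddMeas f) (hg : BddMeas g) :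
    BddMeas fun t => (f t, g t) := by
  obtain ⟨hf, M, hM⟩ := hf
  obtain ⟨hg, N, hN⟩ := hg
  exact ⟨hf.prodMk hg, max M N, fun t => max_le_max (hM t) (hN t)⟩

theorem comp_continuous [ProperSpace W] {f : ℝ → W} (hf : BddMeas f) {φ : W → W'}
    (hφ : Continuous φ) : BddMeas fun t => φ (f t) := by
  obtain ⟨hf, M, hM⟩ := hf
  obtain ⟨N, hN⟩ := (isCompact_closedBall (0 : W) M).exists_bound_of_continuousOn hφ.continuousOn
  exact ⟨hφ.comp_stronglyMeasurable hf, N, fun t => hN _ (by simpa using hM t)⟩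

theorem clm_apply {A : ℝ → W →L[ℝ] W'} {f : ℝ → W} (hA : BddMeas A) (hf : BddMeas f) :
    BddMeas fun t => A t (f t) := by
  obtain ⟨hA, M, hM⟩ := hA
  obtain ⟨hf, N, hN⟩ := hf
  refine ⟨isBoundedBilinearMap_apply.continuous.comp_stronglyMeasurable (hA.prodMk hf), M * N,
    fun t => ?_⟩
  have : 0 ≤ M := (norm_nonneg _).trans (hM t)
  exact ((A t).le_opNorm _).trans (by gcongr; exacts [hM t, hN t])

theorem clm_comp {W'' : Type*} [NormedAddCommGroup W''] [NormedSpace ℝ W'']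
    {A : ℝ → W' →L[ℝ] W''} {B : ℝ → W →L[ℝ] W'} (hA : BddMeas A) (hB : BddMeas B) :
    BddMeas fun t => (A t).comp (B t) := by
  obtain ⟨hA, M, hM⟩ := hA
  obtain ⟨hB, N, hN⟩ := hB
  refine ⟨isBoundedBilinearMap_comp.continuous.comp_stronglyMeasurable (hA.prodMk hB), M * N,
    fun t => ?_⟩
  have : 0 ≤ M := (norm_nonneg _).trans (hM t)
  exact ((A t).opNorm_comp_le _).trans (by gcongr; exacts [hM t, hN t])

theorem smul_fun {r : ℝ → ℝ} {f : ℝ → W} (hr : BddMeas r) (hf : BddMeas f) :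
    BddMeas fun t => r t • f t := by
  obtain ⟨hr, M, hM⟩ := hr
  obtain ⟨hf, N, hN⟩ := hf
  refine ⟨hr.smul hf, M * N, fun t => ?_⟩
  have : 0 ≤ M := (norm_nonneg _).trans (hM t)
  rw [norm_smul]
  gcongr
  exacts [hM t, hN t]

theorem of_bcf (x : BoundedContinuousFunction ℝ W) : BddMeas x :=
  ⟨x.continuous.stronglyMeasurable, ‖x‖, x.norm_coe_le_norm⟩

theorem integrable {f : ℝ → W} (hf : BddMeas f) (T : ℝ) : Integrable f (timeMeasure T) := by
  obtain ⟨hf, M, hM⟩ := hf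
  exact Integrable.of_bound hf.aestronglyMeasurable M (.of_forall hM)

end BddMeas

/-- The primitive `t ↦ ∫ₐᵗ f` of a function on `[0,T]`, extended by constants. -/
noncomputable def prim (T a : ℝ) (f : ℝ → W) (hf : Integrable f (timeMeasure T)) :
    BoundedContinuousFunction ℝ W :=
  BoundedContinuousFunction.ofNormedAddCommGroup (fun t => ∫ s in a..t, f s ∂timeMeasure T)
    (intervalIntegral.continuous_primitive (fun _ _ => hf.intervalIntegrable) a)
    (∫ s, ‖f s‖ ∂timeMeasure T) (fun _ =>
      (intervalIntegral.norm_integral_le_integral_norm_uIoc).trans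
        (setIntegral_le_integral hf.norm (.of_forall fun _ => norm_nonneg _)))

theorem prim_apply (T a : ℝ) {f : ℝ → W} (hf : Integrable f (timeMeasure T)) (t : ℝ) :
    prim T a f hf t = ∫ s in a..t, f s ∂timeMeasure T := rfl

theorem norm_prim_le (T a : ℝ) {f : ℝ → W} (hf : Integrable f (timeMeasure T)) :
    ‖prim T a f hf‖ ≤ ∫ s, ‖f s‖ ∂timeMeasure T :=
  BoundedContinuousFunction.norm_ofNormedAddCommGroup_le _
    (integral_nonneg fun _ => norm_nonneg _) _

theorem norm_prim_le_of_bound {T : ℝ} (hT : 0 ≤ T) (a : ℝ) {f : ℝ → W}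
    (hf : Integrable f (timeMeasure T)) {M : ℝ} (hM : ∀ t, ‖f t‖ ≤ M) :
    ‖prim T a f hf‖ ≤ M * T := by
  refine (norm_prim_le T a hf).trans ?_
  calc _ ≤ ∫ _, M ∂timeMeasure T := integral_mono hf.norm (integrable_const _) hM
    _ = _ := by simp [hT, mul_comm]

theorem prim_add (T a : ℝ) {f g : ℝ → W} (hf : Integrable f (timeMeasure T))
    (hg : Integrable g (timeMeasure T)) :
    prim T a (fun t => f t + g t) (hf.add hg) = prim T a f hf + prim T a g hg := by
  ext t
  exact intervalIntegral.integral_add hf.intervalIntegrable hg.intervalIntegrable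

theorem prim_sub (T a : ℝ) {f g : ℝ → W} (hf : Integrable f (timeMeasure T))
    (hg : Integrable g (timeMeasure T)) :
    prim T a (fun t => f t - g t) (hf.sub hg) = prim T a f hf - prim T a g hg := by
  ext t
  exact intervalIntegral.integral_sub hf.intervalIntegrable hg.intervalIntegrable

theorem prim_smul (T a : ℝ) {f : ℝ → W} (hf : Integrable f (timeMeasure T)) (c : ℝ) :
    prim T a (fun t => c • f t) (hf.smul c) = c • prim T a f hf := by
  ext t
  exact intervalIntegral.integral_smul _ _

theorem intervalIntegral_timeMeasure {T a t : ℝ} (ha : a ∈ Set.Icc 0 T) (ht : t ∈ Set.Icc 0 T)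
    (f : ℝ → W) : ∫ s in a..t, f s ∂timeMeasure T = ∫ s in a..t, f s := by
  have h : ∀ u v : ℝ, u ∈ Set.Icc 0 T → v ∈ Set.Icc 0 T → Set.Ioc u v ∩ Set.Icc 0 T = Set.Ioc u v :=
    fun u v hu hv => Set.inter_eq_left.2 fun s hs =>
      ⟨hu.1.trans hs.1.le, hs.2.trans hv.2⟩
  rw [intervalIntegral, intervalIntegral, timeMeasure, Measure.restrict_restrict measurableSet_Ioc,
    Measure.restrict_restrict measurableSet_Ioc, h a t ha ht, h t a ht ha]

theorem integral_timeMeasure {T : ℝ} (hT : 0 ≤ T) (f : ℝ → W) :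
    ∫ s in 0..T, f s ∂timeMeasure T = ∫ s, f s ∂timeMeasure T := by
  rw [intervalIntegral_timeMeasure ⟨le_rfl, hT⟩ ⟨hT, le_rfl⟩, intervalIntegral.integral_of_le hT,
    integral_Icc_eq_integral_Ioc]

/-- The projection of the real line onto `[0,T]`. -/
noncomputable def clampTime (T t : ℝ) : ℝ := max 0 (min t T)

theorem clampTime_mem {T : ℝ} (hT : 0 ≤ T) (t : ℝ) : clampTime T t ∈ Set.Icc 0 T :=
  ⟨le_max_left _ _, max_le hT (min_le_right _ _)⟩

/-- The measure does not charge the complement of `[0,T]`, so estimates on `[0,T]` control the sup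
norm on the whole line. -/
theorem prim_clampTime {T : ℝ} (hT : 0 ≤ T) (a : ℝ) {f : ℝ → W}
    (hf : Integrable f (timeMeasure T)) (t : ℝ) :
    prim T a f hf (clampTime T t) = prim T a f hf t := by
  have hz : ∀ u v, Set.Ioc u v ∩ Set.Icc 0 T ⊆ {0} → ∫ s in u..v, f s ∂timeMeasure T = 0 ∨ v < u := by
    intro u v h
    rcases le_or_gt u v with huv | huv
    · left
      rw [intervalIntegral.integral_of_le huv, timeMeasure,
        Measure.restrict_restrict measurableSet_Ioc]
      have : volume (Set.Ioc u v ∩ Set.Icc 0 T) = 0 :=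
        measure_mono_null h (measure_singleton 0)
      rw [Measure.restrict_eq_zero.2 this, integral_zero_measure]
    · exact Or.inr huv
  rw [prim_apply, prim_apply, ← sub_eq_zero, intervalIntegral.integral_interval_sub_left
    hf.intervalIntegrable hf.intervalIntegrable]
  rcases le_or_gt t 0 with h0 | h0
  · have e : clampTime T t = 0 := by rw [clampTime, min_eq_left (h0.trans hT), max_eq_left h0]
    rw [e]
    refine (hz t 0 fun s hs => ?_).resolve_right h0.not_gt
    exact le_antisymm hs.1.2 hs.2.1
  rcases le_or_gt t T with h1 | h1
  · have e : clampTime T t = t := by rw [clampTime, min_eq_left h1, max_eq_right h0.le]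
    rw [e, intervalIntegral.integral_same]
  · have e : clampTime T t = T := by rw [clampTime, min_eq_right h1.le, max_eq_right hT]
    rw [e, intervalIntegral.integral_symm, neg_eq_zero]
    refine (hz T t fun s hs => ?_).resolve_right h1.not_gt
    exact absurd hs.1.1 hs.2.2.not_gt

theorem norm_prim_sub_le {T a : ℝ} {f : ℝ → W} (hf : Integrable f (timeMeasure T))
    {M : ℝ} (hM : ∀ t, ‖f t‖ ≤ M) {t t' : ℝ} (ht : t ∈ Set.Icc 0 T) (ht' : t' ∈ Set.Icc 0 T) :
    ‖prim T a f hf t - prim T a f hf t'‖ ≤ M * |t - t'| := by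
  rw [prim_apply, prim_apply, intervalIntegral.integral_interval_sub_left
    hf.intervalIntegrable hf.intervalIntegrable, intervalIntegral_timeMeasure ht' ht]
  exact intervalIntegral.norm_integral_le_of_norm_le_const fun s _ => hM s

theorem ae_mem_Ioo (T : ℝ) : ∀ᵐ t ∂timeMeasure T, t ∈ Set.Ioo 0 T := by
  rw [timeMeasure, ← Measure.restrict_congr_set Ioo_ae_eq_Icc]
  exact ae_restrict_mem measurableSet_Ioo

theorem ae_hasDerivAt_prim [CompleteSpace W] {T a : ℝ} (ha : a ∈ Set.Icc 0 T) {f : ℝ → W}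
    (hf : BddMeas f) :
    ∀ᵐ t ∂timeMeasure T, HasDerivAt (prim T a f (hf.integrable T)) (f t) t := by
  have hloc : LocallyIntegrable f volume := by
    obtain ⟨hf, M, hM⟩ := hf
    exact (locallyIntegrable_const M).mono hf.aestronglyMeasurable
      (.of_forall fun t => (hM t).trans (le_abs_self M))
  filter_upwards [ae_restrict_of_ae (LocallyIntegrable.ae_hasDerivAt_integral hloc), ae_mem_Ioo T] with t ht hmem
  refine (ht a).congr_of_eventuallyEq ?_
  filter_upwards [Ioo_mem_nhds hmem.1 hmem.2] with s hs
  rw [prim_apply, intervalIntegral_timeMeasure ha (Set.Ioo_subset_Icc_self hs)]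

/-- `x` is the integral of the bounded measurable function `f` over `[0,T]`. -/
def IsIntegralOf (T : ℝ) (x : BoundedContinuousFunction ℝ W) (f : ℝ → W) : Prop :=
  ∃ hf : BddMeas f, ∀ t, x t = x 0 + prim T 0 f (hf.integrable T) t

theorem isIntegralOf_of_eq {T a : ℝ} {x : BoundedContinuousFunction ℝ W} {f : ℝ → W} {c : W}
    (hf : BddMeas f) (h : ∀ t, x t = c + prim T a f (hf.integrable T) t) : IsIntegralOf T x f := by
  refine ⟨hf, fun t => ?_⟩
  have hi : ∀ u v, IntervalIntegrable f (timeMeasure T) u v :=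
    fun u v => (hf.integrable T).intervalIntegrable
  rw [h t, h 0, add_assoc]
  simp only [prim_apply]
  rw [intervalIntegral.integral_add_adjacent_intervals (hi _ _) (hi _ _)]

namespace IsIntegralOf

theorem lipschitzOnWith {T : ℝ} {x : BoundedContinuousFunction ℝ W} {f : ℝ → W}
    (h : IsIntegralOf T x f) : ∃ K, LipschitzOnWith K x (Set.Icc 0 T) := by
  obtain ⟨hf, hx⟩ := h
  obtain ⟨M, hM⟩ := hf.2
  refine ⟨M.toNNReal, LipschitzOnWith.of_dist_le_mul fun t ht t' ht' => ?_⟩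
  rw [dist_eq_norm, hx t, hx t', add_sub_add_left_eq_sub, Real.dist_eq]
  refine (norm_prim_sub_le _ hM ht ht').trans ?_
  gcongr
  exact Real.le_coe_toNNReal M

theorem ae_hasDerivAt [CompleteSpace W] {T : ℝ} (hT : 0 ≤ T) {x : BoundedContinuousFunction ℝ W}
    {f : ℝ → W} (h : IsIntegralOf T x f) : ∀ᵐ t ∂timeMeasure T, HasDerivAt x (f t) t := by
  obtain ⟨hf, hx⟩ := h
  filter_upwards [ae_hasDerivAt_prim ⟨le_rfl, hT⟩ hf] with t ht
  exact (ht.const_add (x 0)).congr_of_eventuallyEq (.of_forall hx)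

end IsIntegralOf

/-- The difference of `h` and the primitive is Lipschitz, hence absolutely continuous, and has zero
derivative almost everywhere, so it is constant. -/
theorem eq_add_integral_of_lipschitzOnWith [CompleteSpace W] {T : ℝ} (hT : 0 ≤ T) {h : ℝ → W}
    {K : NNReal} (hh : LipschitzOnWith K h (Set.Icc 0 T)) {f : ℝ → W} (hf : BddMeas f)
    (hd : ∀ᵐ t ∂timeMeasure T, HasDerivAt h (f t) t) {t : ℝ} (ht : t ∈ Set.Icc 0 T) :
    h t = h 0 + prim T 0 f (hf.integrable T) t := by
  have h0 : (0 : ℝ) ∈ Set.Icc 0 T := ⟨le_rfl, hT⟩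
  have hu : Set.uIcc 0 T = Set.Icc 0 T := Set.uIcc_of_le hT
  obtain ⟨M, hM⟩ := hf.2
  have hl2 : LipschitzOnWith M.toNNReal (prim T 0 f (hf.integrable T)) (Set.Icc 0 T) :=
    LipschitzOnWith.of_dist_le_mul fun t ht t' ht' => by
      rw [dist_eq_norm, Real.dist_eq]
      refine (norm_prim_sub_le _ hM ht ht').trans ?_
      gcongr
      exact Real.le_coe_toNNReal M
  rw [← hu] at hh hl2
  have hac := hh.absolutelyContinuousOnInterval.sub hl2.absolutelyContinuousOnInterval
  obtain ⟨C, hC⟩ := hac.const_of_ae_hasDerivAt_zero (by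
    rw [hu]
    refine (ae_restrict_iff' measurableSet_Icc).1 ?_
    filter_upwards [hd, ae_hasDerivAt_prim h0 hf] with t h1 h2
    simpa using h1.sub h2)
  have e1 := hC t (hu ▸ ht)
  have e2 := hC 0 (hu ▸ h0)
  simp only [Pi.sub_apply, prim_apply, intervalIntegral.integral_same, sub_zero] at e1 e2
  rw [prim_apply, e2, ← e1]
  abel

/-- Integration by parts for the pairing of a costate with a state. -/
theorem IsIntegralOf.integral_pairing [CompleteSpace W] {T : ℝ} (hT : 0 ≤ T)
    {p : BoundedContinuousFunction ℝ (StrongDual ℝ W)} {x : BoundedContinuousFunction ℝ W}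
    {π : ℝ → StrongDual ℝ W} {χ : ℝ → W} (hp : IsIntegralOf T p π) (hx : IsIntegralOf T x χ) :
    p T (x T) - p 0 (x 0) = ∫ t, (π t (x t) + p t (χ t)) ∂timeMeasure T := by
  have hf : BddMeas fun t => π t (x t) + p t (χ t) :=
    (hp.1.clm_apply (.of_bcf x)).add ((BddMeas.of_bcf p).clm_apply hx.1)
  obtain ⟨K, hK⟩ := hp.lipschitzOnWith
  obtain ⟨L, hL⟩ := hx.lipschitzOnWith
  have hlip : LipschitzOnWith (K * ‖x‖₊ + ‖p‖₊ * L) (fun t => p t (x t)) (Set.Icc 0 T) := by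
    refine LipschitzOnWith.of_dist_le_mul fun t ht t' ht' => ?_
    have e : p t (x t) - p t' (x t') = (p t - p t') (x t) + p t' (x t - x t') := by
      rw [sub_apply, map_sub]
      ring
    have h1 := hK.dist_le_mul t ht t' ht'
    have h2 := hL.dist_le_mul t ht t' ht'
    rw [dist_eq_norm] at h1 h2
    rw [dist_eq_norm, e]
    calc _ ≤ ‖p t - p t'‖ * ‖x t‖ + ‖p t'‖ * ‖x t - x t'‖ :=
          (norm_add_le _ _).trans (add_le_add ((p t - p t').le_opNorm _) ((p t').le_opNorm _))
      _ ≤ (K * dist t t') * ‖x‖ + ‖p‖ * (L * dist t t') := by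
          gcongr
          · exact x.norm_coe_le_norm t
          · exact p.norm_coe_le_norm t'
      _ = _ := by push_cast; ring
  have key := eq_add_integral_of_lipschitzOnWith hT hlip hf (by
    filter_upwards [hp.ae_hasDerivAt hT, hx.ae_hasDerivAt hT] with t h1 h2
    exact h1.clm_apply h2) (t := T) ⟨hT, le_rfl⟩
  rw [key, prim_apply, integral_timeMeasure hT]
  ring

end Primitive

/-! ### Volterra operators and linear differential equations -/

section Volterra

variable {W : Type*} [NormedAddCommGroup W] [NormedSpace ℝ W]

/-- The Volterra operator `y ↦ ∫ₐᵗ A y`. -/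
noncomputable def volterra (T a : ℝ) (A : ℝ → W →L[ℝ] W) (hA : BddMeas A) :
    BoundedContinuousFunction ℝ W →L[ℝ] BoundedContinuousFunction ℝ W :=
  LinearMap.mkContinuousOfExistsBound
    { toFun := fun y => prim T a (fun t => A t (y t)) ((hA.clm_apply (.of_bcf y)).integrable T)
      map_add' := fun y z => by
        rw [← prim_add]
        congr 1
        ext t
        simp
      map_smul' := fun c y => by
        rw [RingHom.id_apply, ← prim_smul]
        congr 1
        ext t
        simp } (by
    obtain ⟨M, hM⟩ := hA.2
    refine ⟨M * ∫ _, 1 ∂timeMeasure T, fun y => (norm_prim_le T a ((hA.clm_apply (.of_bcf y)).integrable T)).trans ?_⟩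
    rw [mul_assoc, mul_comm _ ‖y‖, ← mul_assoc, ← integral_const_mul]
    refine integral_mono_of_nonneg (.of_forall fun t => norm_nonneg _) (integrable_const _)
      (.of_forall fun t => ?_)
    have hM0 : 0 ≤ M := (norm_nonneg _).trans (hM t)
    simp only [mul_one]
    exact ((A t).le_opNorm _).trans (by gcongr; exacts [hM t, y.norm_coe_le_norm t]))

theorem volterra_apply (T a : ℝ) {A : ℝ → W →L[ℝ] W} (hA : BddMeas A)
    (y : BoundedContinuousFunction ℝ W) :
    volterra T a A hA y = prim T a (fun t => A t (y t))
      ((hA.clm_apply (.of_bcf y)).integrable T) := rfl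

theorem norm_volterra_pow_apply_le {T a : ℝ} (ha : a ∈ Set.Icc 0 T) {A : ℝ → W →L[ℝ] W}
    (hA : BddMeas A) {M : ℝ} (hM : ∀ t, ‖A t‖ ≤ M) (y : BoundedContinuousFunction ℝ W) (k : ℕ) :
    ∀ t ∈ Set.Icc 0 T,
      ‖((volterra T a A hA) ^ k) y t‖ ≤ M ^ k * (|t - a| ^ k / k.factorial) * ‖y‖ := by
  have hM0 : 0 ≤ M := (norm_nonneg _).trans (hM 0)
  induction k with
  | zero => intro t _; simpa using y.norm_coe_le_norm t
  | succ k ih =>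
    intro t ht
    rw [pow_succ', mul_apply_eq_comp, volterra_apply, prim_apply,
      intervalIntegral_timeMeasure ha ht]
    have hsub : Set.uIoc a t ⊆ Set.Icc 0 T :=
      Set.uIoc_subset_uIcc.trans (Set.uIcc_subset_Icc ha ht)
    have hb := intervalIntegral.norm_integral_le_abs_of_norm_le (a := a) (b := t) (μ := volume)
      (f := fun s => A s ((volterra T a A hA ^ k) y s))
      (g := fun s => M ^ (k + 1) / k.factorial * ‖y‖ * |s - a| ^ k)
      ((ae_restrict_iff' measurableSet_uIoc).2 (.of_forall fun s hs => by
        calc _ ≤ M * (M ^ k * (|s - a| ^ k / k.factorial) * ‖y‖) :=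
              ((A s).le_opNorm _).trans (by gcongr; exacts [hM s, ih s (hsub hs)])
          _ = _ := by ring))
      (by apply Continuous.intervalIntegrable; fun_prop)
    refine hb.trans (le_of_eq ?_)
    rw [intervalIntegral.integral_const_mul, abs_mul, intervalIntegral.abs_intervalIntegral_eq,
      integral_pow_abs_sub_uIoc, abs_of_nonneg (by positivity), abs_of_nonneg (by positivity),
      Nat.factorial_succ]
    push_cast
    field_simp

/-- The iterates satisfy `‖K^k‖ ≤ (MT)^k / k!` for `k ≥ 1`, so some `1 - K^k` is invertible; it is
the product of `1 - K` and a geometric sum commuting with it. No smallness of `T` is needed. -/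
theorem isUnit_one_sub_volterra [CompleteSpace W] {T a : ℝ} (ha : a ∈ Set.Icc 0 T)
    {A : ℝ → W →L[ℝ] W} (hA : BddMeas A) : IsUnit (1 - volterra T a A hA) := by
  obtain ⟨M, hM⟩ := hA.2
  have hM0 : 0 ≤ M := (norm_nonneg _).trans (hM 0)
  have hT : 0 ≤ T := ha.1.trans ha.2
  set K := volterra T a A hA with hK
  have hnorm : ∀ k : ℕ, ‖K ^ (k + 1)‖ ≤ (M * T) ^ (k + 1) / (k + 1).factorial := by
    intro k
    refine ContinuousLinearMap.opNorm_le_bound _ (by positivity) fun y => ?_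
    refine (BoundedContinuousFunction.norm_le (by positivity)).2 fun t => ?_
    have hc := clampTime_mem hT t
    -- The exponent is at least one, so this is a primitive and is constant outside `[0,T]`.
    have e : (K ^ (k + 1)) y t = (K ^ (k + 1)) y (clampTime T t) := by
      rw [pow_succ', mul_apply_eq_comp, hK, volterra_apply, prim_clampTime hT]
    rw [e]
    refine (norm_volterra_pow_apply_le ha hA hM y (k + 1) _ hc).trans ?_
    have habs : |clampTime T t - a| ≤ T :=
      abs_le.2 ⟨by linarith [hc.1, ha.2], by linarith [hc.2, ha.1]⟩
    rw [mul_pow, mul_div_assoc]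
    gcongr
  obtain ⟨k, hk⟩ : ∃ k : ℕ, (M * T) ^ (k + 1) / (k + 1).factorial < 1 :=
    (((FloorSemiring.tendsto_pow_div_factorial_atTop (M * T)).comp
      (Filter.tendsto_add_atTop_nat 1)).eventually_lt_const one_pos).exists
  have hu : IsUnit (1 - K ^ (k + 1)) := isUnit_one_sub_of_norm_lt_one ((hnorm k).trans_lt hk)
  rw [← mul_neg_geom_sum] at hu
  have hcomm : Commute (1 - K) (∑ i ∈ Finset.range (k + 1), K ^ i) := by
    rw [commute_iff_eq, mul_neg_geom_sum, geom_sum_mul_neg]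
  exact (hcomm.isUnit_mul_iff.1 hu).1

end Volterra

namespace IsIntegralOf

variable {W : Type*} [NormedAddCommGroup W] [NormedSpace ℝ W] {T : ℝ}
  {x y : BoundedContinuousFunction ℝ W} {f h : ℝ → W}

theorem add (hx : IsIntegralOf T x f) (hy : IsIntegralOf T y h) :
    IsIntegralOf T (x + y) fun t => f t + h t := by
  obtain ⟨hf, hx⟩ := hx
  obtain ⟨hh, hy⟩ := hy
  refine ⟨hf.add hh, fun t => ?_⟩
  have := congrArg (fun z : BoundedContinuousFunction ℝ W => z t)
    (prim_add T 0 (hf.integrable T) (hh.integrable T))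
  rw [this, BoundedContinuousFunction.add_apply, BoundedContinuousFunction.add_apply,
    BoundedContinuousFunction.add_apply, hx t, hy t]
  abel

theorem const_smul (hx : IsIntegralOf T x f) (c : ℝ) :
    IsIntegralOf T (c • x) fun t => c • f t := by
  obtain ⟨hf, hx⟩ := hx
  refine ⟨hf.const_smul c, fun t => ?_⟩
  have := congrArg (fun z : BoundedContinuousFunction ℝ W => z t)
    (prim_smul T 0 (hf.integrable T) c)
  rw [this, BoundedContinuousFunction.smul_apply, BoundedContinuousFunction.smul_apply,
    BoundedContinuousFunction.smul_apply, hx t, smul_add]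

theorem congr (hx : IsIntegralOf T x f) (hfh : ∀ t, f t = h t) : IsIntegralOf T x h := by
  rwa [← funext hfh]

end IsIntegralOf

/-- The time `a` is arbitrary so that both the state equation, started at `0`, and the costate
equation, started at `T`, are covered. -/
theorem exists_linear_solution {W : Type*} [NormedAddCommGroup W] [NormedSpace ℝ W]
    [CompleteSpace W] {T a : ℝ} (ha : a ∈ Set.Icc 0 T) {A : ℝ → W →L[ℝ] W} (hA : BddMeas A)
    {χ : ℝ → W} (hχ : BddMeas χ) (c : W) :
    ∃ y : BoundedContinuousFunction ℝ W, y a = c ∧ IsIntegralOf T y fun t => A t (y t) + χ t := by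
  obtain ⟨u, hu⟩ := isUnit_one_sub_volterra ha hA
  set h := BoundedContinuousFunction.const ℝ c + prim T a χ (hχ.integrable T) with hh
  set y := (↑u⁻¹ : BoundedContinuousFunction ℝ W →L[ℝ] BoundedContinuousFunction ℝ W) h with hy
  have key : y - volterra T a A hA y = h := by
    have : ((1 : BoundedContinuousFunction ℝ W →L[ℝ] BoundedContinuousFunction ℝ W)
        - volterra T a A hA) y = h := by
      rw [← hu, hy, ← mul_apply_eq_comp, Units.mul_inv, one_apply_eq_self]
    simpa using this
  have hfy : BddMeas fun t => A t (y t) := hA.clm_apply (.of_bcf y)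
  have key2 : ∀ t, y t = c + prim T a (fun t => A t (y t) + χ t)
      ((hfy.add hχ).integrable T) t := by
    intro t
    have e := congrArg (fun z : BoundedContinuousFunction ℝ W => z t)
      (prim_add T a (hfy.integrable T) (hχ.integrable T))
    rw [e, ← volterra_apply T a hA y]
    have e2 := congrArg (fun z : BoundedContinuousFunction ℝ W => z t) (sub_eq_iff_eq_add.1 key)
    simp only [hh, BoundedContinuousFunction.add_apply, BoundedContinuousFunction.const_apply] at e2
    rw [e2, BoundedContinuousFunction.add_apply]
    abel
  exact ⟨y, by rw [key2 a, prim_apply, intervalIntegral.integral_same, add_zero],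
    isIntegralOf_of_eq (hfy.add hχ) key2⟩

/-- A reference trajectory `(x, c)` of the control system `ẋ = G(x, c)` on `[0,T]`, with a map `g`
of the endpoints `(x 0, x T)`. -/
structure ReferenceProcess (X C Y : Type*) [NormedAddCommGroup X] [NormedSpace ℝ X]
    [NormedAddCommGroup C] [NormedSpace ℝ C] [NormedAddCommGroup Y] [NormedSpace ℝ Y] where
  T : ℝ
  T_pos : 0 < T
  G : X × C → X
  contDiff_G : ContDiff ℝ 2 G
  g : X × X → Y
  contDiff_g : ContDiff ℝ 2 g
  x : BoundedContinuousFunction ℝ X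
  c : ℝ → C
  bddMeas_c : BddMeas c
  isIntegralOf_x : IsIntegralOf T x fun t => G (x t, c t)

/-! ### The linearized control system and the adjoint identity -/

namespace ReferenceProcess

variable {X C Y : Type*} [NormedAddCommGroup X] [NormedSpace ℝ X] [FiniteDimensional ℝ X]
    [NormedAddCommGroup C] [NormedSpace ℝ C] [FiniteDimensional ℝ C]
    [NormedAddCommGroup Y] [NormedSpace ℝ Y] (Q : ReferenceProcess X C Y)

theorem zero_mem : (0 : ℝ) ∈ Set.Icc 0 Q.T := ⟨le_rfl, Q.T_pos.le⟩

/-- The reference point `(x t, c t)`. -/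
def base (t : ℝ) : X × C := (Q.x t, Q.c t)

theorem bddMeas_base : BddMeas Q.base := (BddMeas.of_bcf Q.x).prodMk Q.bddMeas_c

/-- The derivative of the dynamics along the reference trajectory. -/
noncomputable def D (t : ℝ) : X × C →L[ℝ] X := fderiv ℝ Q.G (Q.base t)

theorem bddMeas_D : BddMeas Q.D :=
  haveI := FiniteDimensional.proper_real (X × C)
  Q.bddMeas_base.comp_continuous (Q.contDiff_G.continuous_fderiv (by norm_num))

/-- The derivative of the dynamics in the state. -/
noncomputable def A (t : ℝ) : X →L[ℝ] X := (Q.D t).comp (ContinuousLinearMap.inl ℝ X C)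

/-- The derivative of the dynamics in the control. -/
noncomputable def B (t : ℝ) : C →L[ℝ] X := (Q.D t).comp (ContinuousLinearMap.inr ℝ X C)

theorem bddMeas_A : BddMeas Q.A := Q.bddMeas_D.clm_comp (.const _)

theorem bddMeas_B : BddMeas Q.B := Q.bddMeas_D.clm_comp (.const _)

theorem D_apply (t : ℝ) (a : X) (b : C) : Q.D t (a, b) = Q.A t a + Q.B t b := by
  simp [A, B, ← map_add]

/-- The endpoints of a state. -/
noncomputable def ends : BoundedContinuousFunction ℝ X →L[ℝ] X × X :=
  (BoundedContinuousFunction.evalCLM ℝ 0).prod (BoundedContinuousFunction.evalCLM ℝ Q.T)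

@[simp] theorem ends_apply (y : BoundedContinuousFunction ℝ X) : Q.ends y = (y 0, y Q.T) := rfl

theorem norm_ends_le (y : BoundedContinuousFunction ℝ X) : ‖Q.ends y‖ ≤ ‖y‖ :=
  max_le (y.norm_coe_le_norm _) (y.norm_coe_le_norm _)

/-- The derivative of the endpoint map at the endpoints of the reference trajectory. -/
noncomputable def Dg : X × X →L[ℝ] Y := fderiv ℝ Q.g (Q.ends Q.x)

/-- The solutions `(ψ, y)` of the linearized state equation. -/
def linVar : Submodule ℝ ((ℝ → C) × BoundedContinuousFunction ℝ X) where
  carrier := {w | BddMeas w.1 ∧ IsIntegralOf Q.T w.2 fun t => Q.D t (w.2 t, w.1 t)}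
  add_mem' := by
    rintro w w' ⟨h1, h2⟩ ⟨h1', h2'⟩
    exact ⟨h1.add h1', (h2.add h2').congr fun t => by rw [← map_add]; rfl⟩
  zero_mem' := by
    have h : (fun t => Q.D t ((0 : BoundedContinuousFunction ℝ X) t, (0 : ℝ → C) t)) =
        fun _ => 0 := by
      ext t
      simp [Prod.mk_zero_zero]
    refine ⟨.const 0, ?_⟩
    change IsIntegralOf Q.T 0 (fun t => Q.D t ((0 : BoundedContinuousFunction ℝ X) t, (0 : ℝ → C) t))
    rw [h]
    exact ⟨.const 0, fun t => by simp [prim_apply]⟩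
  smul_mem' := by
    rintro c w ⟨h1, h2⟩
    exact ⟨h1.const_smul c, (h2.const_smul c).congr fun t => by rw [← map_smul]; rfl⟩

theorem exists_mem_linVar {ψ : ℝ → C} (hψ : BddMeas ψ) (ξ : X) :
    ∃ y : BoundedContinuousFunction ℝ X, y 0 = ξ ∧ (ψ, y) ∈ Q.linVar := by
  have := FiniteDimensional.complete ℝ X
  obtain ⟨y, hy, h⟩ := exists_linear_solution Q.zero_mem Q.bddMeas_A
    (Q.bddMeas_B.clm_apply hψ) ξ
  exact ⟨y, hy, hψ, h.congr fun t => (Q.D_apply t _ _).symm⟩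

/-- The first variation of the endpoint map. -/
noncomputable def firstVar : Q.linVar →ₗ[ℝ] Y :=
  (Q.Dg.comp Q.ends).toLinearMap.comp
    ((LinearMap.snd ℝ (ℝ → C) (BoundedContinuousFunction ℝ X)).comp Q.linVar.subtype)

theorem firstVar_apply (w : Q.linVar) : Q.firstVar w = Q.Dg (Q.ends w.1.2) := rfl

/-- The operator `1 - K`, where `K y = ∫ A y`. -/
noncomputable def volterraUnit :
    (BoundedContinuousFunction ℝ X →L[ℝ] BoundedContinuousFunction ℝ X)ˣ :=
  haveI := FiniteDimensional.complete ℝ X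
  (isUnit_one_sub_volterra Q.zero_mem Q.bddMeas_A).unit

/-- The solution operator of `ζ = z + ∫ A ζ`. -/
noncomputable def S : BoundedContinuousFunction ℝ X →L[ℝ] BoundedContinuousFunction ℝ X :=
  (↑Q.volterraUnit⁻¹ : BoundedContinuousFunction ℝ X →L[ℝ] BoundedContinuousFunction ℝ X)

theorem S_eq (z : BoundedContinuousFunction ℝ X) :
    Q.S z = z + volterra Q.T 0 Q.A Q.bddMeas_A (Q.S z) := by
  have : ((1 : BoundedContinuousFunction ℝ X →L[ℝ] BoundedContinuousFunction ℝ X)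
        - volterra Q.T 0 Q.A Q.bddMeas_A) (Q.S z) = z := by
    have hu : (Q.volterraUnit : BoundedContinuousFunction ℝ X →L[ℝ] BoundedContinuousFunction ℝ X)
      = 1 - volterra Q.T 0 Q.A Q.bddMeas_A := IsUnit.unit_spec _
    rw [← hu, S, ← mul_apply_eq_comp, Units.mul_inv, one_apply_eq_self]
  rw [sub_apply, one_apply_eq_self, sub_eq_iff_eq_add] at this
  exact this

theorem isIntegralOf_S_prim {χ : ℝ → X} (hχ : BddMeas χ) :
    Q.S (prim Q.T 0 χ (hχ.integrable _)) 0 = 0 ∧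
      IsIntegralOf Q.T (Q.S (prim Q.T 0 χ (hχ.integrable _)))
        fun t => Q.A t (Q.S (prim Q.T 0 χ (hχ.integrable _)) t) + χ t := by
  set ζ := Q.S (prim Q.T 0 χ (hχ.integrable _)) with hζ
  have hA : BddMeas fun t => Q.A t (ζ t) := Q.bddMeas_A.clm_apply (.of_bcf ζ)
  have key : ∀ t, ζ t = 0 + prim Q.T 0 (fun t => Q.A t (ζ t) + χ t)
      ((hA.add hχ).integrable _) t := by
    intro t
    have e := congrArg (fun z : BoundedContinuousFunction ℝ X => z t)
      (prim_add Q.T 0 (hA.integrable _) (hχ.integrable _))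
    have e2 := congrArg (fun z : BoundedContinuousFunction ℝ X => z t)
      (Q.S_eq (prim Q.T 0 χ (hχ.integrable _)))
    rw [e, zero_add]
    simp only [← hζ, volterra_apply, BoundedContinuousFunction.add_apply] at e2 ⊢
    rw [e2, add_comm]
  exact ⟨by rw [key 0, prim_apply, intervalIntegral.integral_same, add_zero],
    isIntegralOf_of_eq (hA.add hχ) key⟩

/-- `p` is the costate of the functional `Λ` of the endpoints. -/
structure IsCostate (Λ : StrongDual ℝ Y) (p : BoundedContinuousFunction ℝ (StrongDual ℝ X)) :
    Prop where
  isIntegralOf : IsIntegralOf Q.T p fun t => -(p t).comp (Q.A t)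
  zero : ∀ a, p 0 a = -Λ (Q.Dg (a, 0))
  final : ∀ a, p Q.T a = Λ (Q.Dg (0, a))

-- Along the adjoint equation the derivative of `p(y)` is `p(χ)`, and the two boundary conditions
-- turn the boundary terms into `Λ ∘ Dg`. Thus the endpoint effect of a source term becomes an
-- integral against the costate.
variable {Q} in
theorem IsCostate.apply_ends {Λ : StrongDual ℝ Y}
    {p : BoundedContinuousFunction ℝ (StrongDual ℝ X)} (hp : Q.IsCostate Λ p)
    {y : BoundedContinuousFunction ℝ X} {χ : ℝ → X}
    (hy : IsIntegralOf Q.T y fun t => Q.A t (y t) + χ t) :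
    Λ (Q.Dg (Q.ends y)) = ∫ t, p t (χ t) ∂timeMeasure Q.T := by
  have := FiniteDimensional.complete ℝ X
  have key := hp.isIntegralOf.integral_pairing Q.T_pos.le hy
  have e : Q.ends y = (y 0, 0) + (0, y Q.T) := by simp
  rw [e, map_add, map_add]
  have h0 := hp.zero (y 0)
  have h1 := hp.final (y Q.T)
  have : Λ (Q.Dg (y 0, 0)) + Λ (Q.Dg (0, y Q.T)) = p Q.T (y Q.T) - p 0 (y 0) := by
    rw [h0, h1]; ring
  rw [this, key]
  refine integral_congr_ae (.of_forall fun t => ?_)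
  simp

end ReferenceProcess

/-- Controls are plain functions without a norm, so automatic continuity does not apply; the bound
comes from expanding in a basis. -/
theorem exists_bound_of_finiteDimensional {R C : Type*} [NormedAddCommGroup R] [NormedSpace ℝ R]
    [FiniteDimensional ℝ R] [NormedAddCommGroup C] [NormedSpace ℝ C] (f : R →ₗ[ℝ] (ℝ → C))
    (hf : ∀ r, ∃ M, ∀ t, ‖f r t‖ ≤ M) : ∃ M, 0 ≤ M ∧ ∀ r t, ‖f r t‖ ≤ M * ‖r‖ := by
  choose M hM using hf
  set b := Module.finBasis ℝ R
  have hM0 : ∀ i, 0 ≤ M (b i) := fun i => (norm_nonneg _).trans (hM (b i) 0)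
  set L := b.equivFunL.toContinuousLinearMap with hL
  refine ⟨∑ i, ‖L‖ * M (b i), Finset.sum_nonneg fun i _ => mul_nonneg (norm_nonneg _) (hM0 i),
    fun r t => ?_⟩
  have e : f r t = ∑ i, b.repr r i • f (b i) t := by
    have := congrArg (fun x => f x t) (b.sum_repr r)
    simp only [map_sum, map_smul, Finset.sum_apply, Pi.smul_apply] at this
    exact this.symm
  rw [e, Finset.sum_mul]
  refine (norm_sum_le _ _).trans (Finset.sum_le_sum fun i _ => ?_)
  rw [norm_smul]
  have h1 : ‖b.repr r i‖ ≤ ‖L‖ * ‖r‖ := (norm_le_pi_norm (L r) i).trans (L.le_opNorm r)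
  calc _ ≤ ‖L‖ * ‖r‖ * M (b i) := by gcongr; exact hM _ _
    _ = _ := by ring

/-! ### Second-order expansion of the endpoint map -/

section SecondOrder

variable {Z W : Type*} [NormedAddCommGroup Z] [NormedSpace ℝ Z] [FiniteDimensional ℝ Z]
  [NormedAddCommGroup W] [NormedSpace ℝ W]

theorem exists_abs_apply_taylorRem_sub_le {G : Z → W} (hG : ContDiff ℝ 2 G) (M N P : ℝ) {η : ℝ}
    (hη : 0 < η) :
    ∃ s₀, 0 < s₀ ∧ ∀ s, 0 < s → s < s₀ → ∀ b d : Z, ‖b‖ ≤ M → ‖d‖ ≤ N →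
      ∀ Λ : StrongDual ℝ W, ‖Λ‖ ≤ P →
      |Λ (taylorRem G b (s • d)) - s ^ 2 * (1 / 2 * Λ (fderiv ℝ (fderiv ℝ G) b d d))|
        ≤ s ^ 2 * η := by
  have := FiniteDimensional.proper_real Z
  set ε := η / (|P| * N ^ 2 + 1) with hε
  have hε0 : 0 < ε := by positivity
  obtain ⟨δ, hδ, h⟩ := exists_norm_taylorRem_sub_half_le hG M hε0
  refine ⟨δ / (|N| + 1), by positivity, fun s hs hss b d hb hd Λ hΛ => ?_⟩
  have hds : ‖s • d‖ ≤ δ := by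
    rw [norm_smul, Real.norm_of_nonneg hs.le]
    rw [lt_div_iff₀ (by positivity)] at hss
    have : s * ‖d‖ ≤ s * (|N| + 1) := by gcongr; linarith [le_abs_self N]
    linarith
  have key := h b hb (s • d) hds
  have e : Λ (taylorRem G b (s • d)) - s ^ 2 * (1 / 2 * Λ (fderiv ℝ (fderiv ℝ G) b d d)) =
      Λ (taylorRem G b (s • d)
        - (1 / 2 : ℝ) • fderiv ℝ (fderiv ℝ G) b (s • d) (s • d)) := by
    simp only [map_sub, map_smul, smul_apply, smul_eq_mul]
    ring
  rw [e, ← Real.norm_eq_abs]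
  refine (Λ.le_opNorm _).trans ?_
  have hN : ‖d‖ ^ 2 ≤ N ^ 2 := by gcongr
  calc ‖Λ‖ * _ ≤ |P| * (ε * ‖s • d‖ ^ 2) := by gcongr; exact hΛ.trans (le_abs_self P)
    _ = s ^ 2 * (ε * (|P| * ‖d‖ ^ 2)) := by
      rw [norm_smul, Real.norm_of_nonneg hs.le]; ring
    _ ≤ s ^ 2 * (ε * (|P| * N ^ 2 + 1)) := by
      gcongr
      have : |P| * ‖d‖ ^ 2 ≤ |P| * N ^ 2 := by gcongr
      linarith
    _ = s ^ 2 * η := by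
      rw [hε, div_mul_cancel₀ _ (by positivity)]

end SecondOrder

namespace ReferenceProcess

section

variable {X C Y : Type*} [NormedAddCommGroup X] [NormedSpace ℝ X] [FiniteDimensional ℝ X]
    [NormedAddCommGroup C] [NormedSpace ℝ C] [FiniteDimensional ℝ C]
    [NormedAddCommGroup Y] [NormedSpace ℝ Y] (Q : ReferenceProcess X C Y)

/-- Second derivative of the dynamics along the reference trajectory. -/
noncomputable def D2 (t : ℝ) : X × C →L[ℝ] X × C →L[ℝ] X := fderiv ℝ (fderiv ℝ Q.G) (Q.base t)

theorem bddMeas_D2 : BddMeas Q.D2 := by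
  have := FiniteDimensional.proper_real (X × C)
  have h1 : ContDiff ℝ 1 (fderiv ℝ Q.G) := Q.contDiff_G.fderiv_right (by norm_num)
  exact Q.bddMeas_base.comp_continuous (h1.continuous_fderiv (by norm_num))

/-- Twice the second variation of the Lagrangian. -/
noncomputable def secondVar (Λ : StrongDual ℝ Y) (p : BoundedContinuousFunction ℝ (StrongDual ℝ X))
    (ψ : ℝ → C) (y : BoundedContinuousFunction ℝ X) : ℝ :=
  Λ (fderiv ℝ (fderiv ℝ Q.g) (Q.ends Q.x) (Q.ends y) (Q.ends y)) +
    ∫ t, p t (Q.D2 t (y t, ψ t) (y t, ψ t)) ∂timeMeasure Q.T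

/-- The remainder of the dynamics for the state variation `y` and the control variation `κ`. -/
noncomputable def rem (y : BoundedContinuousFunction ℝ X) (κ : ℝ → C) (t : ℝ) : X :=
  taylorRem Q.G (Q.base t) (y t, κ t)

theorem bddMeas_rem (y : BoundedContinuousFunction ℝ X) {κ : ℝ → C} (hκ : BddMeas κ) :
    BddMeas (Q.rem y κ) := by
  have := FiniteDimensional.proper_real ((X × C) × (X × C))
  exact (Q.bddMeas_base.prodMk ((BddMeas.of_bcf y).prodMk hκ)).comp_continuous
    (continuous_taylorRem Q.contDiff_G)

/-- The second order part of the endpoint map. -/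
noncomputable def endRem (y z : BoundedContinuousFunction ℝ X) : Y :=
  taylorRem Q.g (Q.ends Q.x) (Q.ends y) + Q.Dg (Q.ends (Q.S z))

/-- By the adjoint identity, `Λ` of the endpoint remainder is `s²/2` times the second variation `I`,
up to an error `s² η (T + 1)`. The choice of `η` makes this error `-s² I / 4`, which leaves `s² I /
4`. -/
theorem exists_endRem_le {Λ : StrongDual ℝ Y} {p : BoundedContinuousFunction ℝ (StrongDual ℝ X)}
    (hp : Q.IsCostate Λ p) {ψ : ℝ → C} (hψ : BddMeas ψ) (y : BoundedContinuousFunction ℝ X)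
    (hneg : Q.secondVar Λ p ψ y < 0) :
    ∃ δ s₀, 0 < δ ∧ 0 < s₀ ∧ ∀ s, 0 < s → s < s₀ → ∀ h : BddMeas (Q.rem (s • y) (s • ψ)),
      Λ (Q.endRem (s • y) (prim Q.T 0 (Q.rem (s • y) (s • ψ)) (h.integrable _)))
        ≤ -δ * s ^ 2 := by
  set I := Q.secondVar Λ p ψ y with hI
  set η := -I / (4 * (Q.T + 1)) with hη
  have hT := Q.T_pos
  have hη0 : 0 < η := div_pos (by linarith) (by positivity)
  obtain ⟨M, hM⟩ := Q.bddMeas_base.2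
  have hd : BddMeas fun t => (y t, ψ t) := (BddMeas.of_bcf y).prodMk hψ
  obtain ⟨N, hN⟩ := hd.2
  obtain ⟨s₁, hs₁, h1⟩ := exists_abs_apply_taylorRem_sub_le Q.contDiff_G M N ‖p‖ hη0
  obtain ⟨s₂, hs₂, h2⟩ := exists_abs_apply_taylorRem_sub_le Q.contDiff_g ‖Q.ends Q.x‖
    ‖Q.ends y‖ ‖Λ‖ hη0
  refine ⟨-I / 4, min s₁ s₂, by linarith, by positivity, fun s hs hss h => ?_⟩
  have e1 := h2 s hs (hss.trans_le (min_le_right _ _)) (Q.ends Q.x) (Q.ends y) le_rfl le_rfl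
    Λ le_rfl
  have hS := Q.isIntegralOf_S_prim h
  have hpr := hp.apply_ends hS.2
  have hD2 : BddMeas fun t => p t (Q.D2 t (y t, ψ t) (y t, ψ t)) :=
    (BddMeas.of_bcf p).clm_apply ((Q.bddMeas_D2.clm_apply hd).clm_apply hd)
  have hint : ∫ t, p t (Q.rem (s • y) (s • ψ) t) ∂timeMeasure Q.T ≤
      s ^ 2 * (1 / 2 * ∫ t, p t (Q.D2 t (y t, ψ t) (y t, ψ t)) ∂timeMeasure Q.T)
        + s ^ 2 * η * Q.T := by
    calc _ ≤ ∫ t, (s ^ 2 * (1 / 2 * p t (Q.D2 t (y t, ψ t) (y t, ψ t))) + s ^ 2 * η)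
          ∂timeMeasure Q.T := by
          refine integral_mono (((BddMeas.of_bcf p).clm_apply h).integrable _)
            ((((hD2.integrable _).const_mul _).const_mul _).add (integrable_const _)) fun t => ?_
          have := h1 s hs (hss.trans_le (min_le_left _ _)) (Q.base t) (y t, ψ t) (hM t) (hN t)
            (p t) (p.norm_coe_le_norm t)
          have := (abs_le.1 this).2
          have e : Q.rem (s • y) (s • ψ) t = taylorRem Q.G (Q.base t) (s • (y t, ψ t)) := rfl
          simp only [e]
          change _ - s ^ 2 * (1 / 2 * p t (Q.D2 t (y t, ψ t) (y t, ψ t))) ≤ _ at this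
          linarith
      _ = _ := by
          rw [integral_add (((hD2.integrable _).const_mul _).const_mul _) (integrable_const _),
            integral_const_mul, integral_const_mul]
          simp [hT.le, mul_comm]
  have e2 := (abs_le.1 e1).2
  rw [endRem, map_add, hpr, map_smul]
  have hsum : Λ (fderiv ℝ (fderiv ℝ Q.g) (Q.ends Q.x) (Q.ends y) (Q.ends y)) +
    ∫ t, p t (Q.D2 t (y t, ψ t) (y t, ψ t)) ∂timeMeasure Q.T = I := rfl
  have hη2 : η * (Q.T + 1) = -I / 4 := by
    rw [hη]; field_simp
  calc _ ≤ s ^ 2 * (1 / 2 * I) + s ^ 2 * (η * (Q.T + 1)) := by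
        rw [← hsum]; linarith
    _ = _ := by rw [hη2]; ring

/-- The variation `w.2 + S z` solves the linearized equation with source the Taylor remainder, and
linear part plus remainder is the exact increment of `G`. The nonlinear state equation is thus
reduced to a fixed point equation for `z`. -/
theorem isIntegralOf_x_add {w : (ℝ → C) × BoundedContinuousFunction ℝ X} (hw : w ∈ Q.linVar)
    {z : BoundedContinuousFunction ℝ X} (h : BddMeas (Q.rem (w.2 + Q.S z) w.1))
    (hz : z = prim Q.T 0 (Q.rem (w.2 + Q.S z) w.1) (h.integrable _)) :
    IsIntegralOf Q.T (Q.x + (w.2 + Q.S z))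
      fun t => Q.G ((Q.x + (w.2 + Q.S z)) t, Q.c t + w.1 t) := by
  have hS := (Q.isIntegralOf_S_prim h).2
  rw [← hz] at hS
  refine (Q.isIntegralOf_x.add (hw.2.add hS)).congr fun t => ?_
  have e : Q.D t ((w.2 + Q.S z) t, w.1 t) = Q.D t (w.2 t, w.1 t) + Q.A t (Q.S z t) := by
    rw [D_apply, D_apply, BoundedContinuousFunction.add_apply, map_add]
    abel
  have e2 : ((Q.x + (w.2 + Q.S z)) t, Q.c t + w.1 t) = Q.base t + ((w.2 + Q.S z) t, w.1 t) := rfl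
  rw [e2]
  have e3 : Q.rem (w.2 + Q.S z) w.1 t = Q.G (Q.base t + ((w.2 + Q.S z) t, w.1 t))
    - Q.G (Q.x t, Q.c t) - Q.D t ((w.2 + Q.S z) t, w.1 t) := rfl
  rw [e3, e]
  abel

theorem g_ends_x_add (hg : Q.g (Q.ends Q.x) = 0) (y z : BoundedContinuousFunction ℝ X) :
    Q.g (Q.ends (Q.x + (y + Q.S z))) = Q.Dg (Q.ends y) + Q.endRem (y + Q.S z) z := by
  rw [endRem, taylorRem, hg, map_add Q.ends Q.x]
  change _ = _ + (_ - 0 - Q.Dg (Q.ends (y + Q.S z)) + _)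
  rw [map_add Q.ends y, map_add Q.Dg]
  abel

end

end ReferenceProcess

/-! ### From a negative second variation to a better trajectory -/

namespace ReferenceProcess

variable {X C ι V : Type*} [NormedAddCommGroup X] [NormedSpace ℝ X] [FiniteDimensional ℝ X]
    [NormedAddCommGroup C] [NormedSpace ℝ C] [FiniteDimensional ℝ C]
    [Fintype ι] [DecidableEq ι] [Nonempty ι]
    [NormedAddCommGroup V] [NormedSpace ℝ V] [FiniteDimensional ℝ V]
    (Q : ReferenceProcess X C ((ι → ℝ) × V))

/-- The integral of the remainder of the dynamics. -/
noncomputable def remPrim (y : BoundedContinuousFunction ℝ X) (κ : ℝ → C) (hκ : BddMeas κ) :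
    BoundedContinuousFunction ℝ X :=
  prim Q.T 0 (Q.rem y κ) ((Q.bddMeas_rem y hκ).integrable _)

theorem remPrim_zero : Q.remPrim 0 0 (.const 0) = 0 := by
  ext t
  have : Q.rem 0 0 = fun _ => 0 := by
    ext t
    exact taylorRem_zero _ _
  simp [remPrim, prim_apply, this]

theorem endRem_zero : Q.endRem 0 0 = 0 := by
  rw [endRem, map_zero, map_zero, map_zero, map_zero, taylorRem_zero, add_zero]

theorem exists_norm_remPrim_sub_le :
    ∃ K, 0 ≤ K ∧ ∀ y y' : BoundedContinuousFunction ℝ X, ∀ κ κ' : ℝ → C, ∀ hκ : BddMeas κ,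
      ∀ hκ' : BddMeas κ', ∀ r ≤ 1, ‖y‖ ≤ r → ‖y'‖ ≤ r → (∀ t, ‖κ t‖ ≤ r) → (∀ t, ‖κ' t‖ ≤ r) →
      ∀ D, ‖y - y'‖ ≤ D → (∀ t, ‖κ t - κ' t‖ ≤ D) →
      ‖Q.remPrim y κ hκ - Q.remPrim y' κ' hκ'‖ ≤ K * r * D ∧
      ‖Q.endRem y (Q.remPrim y κ hκ) - Q.endRem y' (Q.remPrim y' κ' hκ')‖ ≤ K * r * D := by
  have := FiniteDimensional.proper_real (X × C)
  have := FiniteDimensional.proper_real (X × X)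
  obtain ⟨M, hM⟩ := Q.bddMeas_base.2
  obtain ⟨K₁, hK₁, hG⟩ := exists_norm_taylorRem_sub_le Q.contDiff_G M
  obtain ⟨K₂, hK₂, hg'⟩ := exists_norm_taylorRem_sub_le Q.contDiff_g ‖Q.ends Q.x‖
  have hT := Q.T_pos
  refine ⟨K₁ * Q.T + (K₂ + ‖Q.Dg‖ * (‖Q.S‖ * (K₁ * Q.T))), by positivity,
    fun y y' κ κ' hκ hκ' r hr hy hy' hκr hκr' D hD hD' => ?_⟩
  have hr0 : 0 ≤ r := (norm_nonneg _).trans hy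
  have hD0 : 0 ≤ D := (norm_nonneg _).trans hD
  have h1 : ‖Q.remPrim y κ hκ - Q.remPrim y' κ' hκ'‖ ≤ K₁ * r * D * Q.T := by
    rw [remPrim, remPrim, ← prim_sub]
    refine norm_prim_le_of_bound hT.le _ _ fun t => ?_
    refine (hG (Q.base t) (hM t) r hr _ _
      (max_le ((y.norm_coe_le_norm t).trans hy) (hκr t))
      (max_le ((y'.norm_coe_le_norm t).trans hy') (hκr' t))).trans ?_
    gcongr
    exact max_le (((y - y').norm_coe_le_norm t).trans hD) (hD' t)
  have h2 : ‖Q.endRem y (Q.remPrim y κ hκ) - Q.endRem y' (Q.remPrim y' κ' hκ')‖ ≤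
      K₂ * r * D + ‖Q.Dg‖ * (‖Q.S‖ * (K₁ * r * D * Q.T)) := by
    have e : Q.endRem y (Q.remPrim y κ hκ) - Q.endRem y' (Q.remPrim y' κ' hκ') =
        (taylorRem Q.g (Q.ends Q.x) (Q.ends y) - taylorRem Q.g (Q.ends Q.x) (Q.ends y'))
        + Q.Dg (Q.ends (Q.S (Q.remPrim y κ hκ - Q.remPrim y' κ' hκ'))) := by
      rw [endRem, endRem, map_sub, map_sub, map_sub]
      abel
    rw [e]
    refine (norm_add_le _ _).trans (add_le_add ?_ ?_)
    · refine (hg' _ le_rfl r hr _ _ ((Q.norm_ends_le _).trans hy)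
        ((Q.norm_ends_le _).trans hy')).trans ?_
      gcongr
      rw [← map_sub]
      exact (Q.norm_ends_le _).trans hD
    · refine (Q.Dg.le_opNorm _).trans ?_
      gcongr
      refine (Q.norm_ends_le _).trans ((Q.S.le_opNorm _).trans ?_)
      gcongr
  constructor
  · calc _ ≤ K₁ * Q.T * (r * D) := h1.trans_eq (by ring)
      _ ≤ (K₁ * Q.T + (K₂ + ‖Q.Dg‖ * (‖Q.S‖ * (K₁ * Q.T)))) * (r * D) := by
        gcongr
        have : 0 ≤ K₂ + ‖Q.Dg‖ * (‖Q.S‖ * (K₁ * Q.T)) := by positivity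
        linarith
      _ = _ := by ring
  · calc _ ≤ (K₂ + ‖Q.Dg‖ * (‖Q.S‖ * (K₁ * Q.T))) * (r * D) := h2.trans_eq (by ring)
      _ ≤ (K₁ * Q.T + (K₂ + ‖Q.Dg‖ * (‖Q.S‖ * (K₁ * Q.T)))) * (r * D) := by
        refine mul_le_mul_of_nonneg_right ?_ (by positivity)
        exact le_add_of_nonneg_left (mul_nonneg hK₁ hT.le)
      _ = _ := by ring

theorem exists_rightInverse_firstVar :
    ∃ σ : LinearMap.range Q.firstVar →ₗ[ℝ] Q.linVar,
      ∀ r, Q.firstVar (σ r) = (r : (ι → ℝ) × V) := by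
  obtain ⟨σ, hσ⟩ := LinearMap.exists_rightInverse_of_surjective Q.firstVar.rangeRestrict
    (LinearMap.range_rangeRestrict _)
  exact ⟨σ, fun r => congrArg Subtype.val (LinearMap.congr_fun hσ r)⟩

/-- The trial variation is `s w + σ r` plus the state correction `S z`. As `w` is critical, its
first-order endpoint displacement is exactly `r`; everything else is a remainder, and
`exists_solution` applies to `(r, z)`. -/
theorem exists_improvement (hg : Q.g (Q.ends Q.x) = 0) {Λ : StrongDual ℝ ((ι → ℝ) × V)}
    (hU : IsUniqueNormal (LinearMap.range Q.firstVar) Λ)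
    {p : BoundedContinuousFunction ℝ (StrongDual ℝ X)} (hp : Q.IsCostate Λ p)
    (w : Q.linVar) (hw : Q.firstVar w = 0) (hneg : Q.secondVar Λ p w.1.1 w.1.2 < 0)
    {ε : ℝ} (hε : 0 < ε) :
    ∃ (y : BoundedContinuousFunction ℝ X) (κ : ℝ → C), BddMeas κ ∧
      IsIntegralOf Q.T (Q.x + y) (fun t => Q.G ((Q.x + y) t, Q.c t + κ t)) ∧
      ‖y‖ ≤ ε ∧ (∀ t, ‖κ t‖ ≤ ε) ∧ (∀ i, (Q.g (Q.ends (Q.x + y))).1 i < 0) ∧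
      (Q.g (Q.ends (Q.x + y))).2 = 0 := by
  have := FiniteDimensional.complete ℝ X
  set R := LinearMap.range Q.firstVar with hR
  obtain ⟨σ, hσ⟩ : ∃ σ : R →ₗ[ℝ] Q.linVar, ∀ r, Q.firstVar (σ r) = (r : (ι → ℝ) × V) :=
    Q.exists_rightInverse_firstVar
  obtain ⟨M₁, hM₁, hσ₁⟩ := exists_bound_of_finiteDimensional
    ((LinearMap.fst ℝ (ℝ → C) (BoundedContinuousFunction ℝ X)).comp
      (Q.linVar.subtype.comp σ)) (fun r => (σ r).2.1.2)
  obtain ⟨M₂, hM₂, hσ₂⟩ : ∃ M, 0 ≤ M ∧ ∀ r : R, ‖(σ r).1.2‖ ≤ M * ‖r‖ := by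
    set L := LinearMap.toContinuousLinearMap
      ((LinearMap.snd ℝ (ℝ → C) (BoundedContinuousFunction ℝ X)).comp (Q.linVar.subtype.comp σ))
    exact ⟨‖L‖, L.opNorm_nonneg, fun r => L.le_opNorm r⟩
  obtain ⟨N₁, hN₁⟩ := w.2.1.2
  have hN₁0 : 0 ≤ N₁ := (norm_nonneg _).trans (hN₁ 0)
  -- the linear part of the state and control variations
  set lin : ℝ → R → Q.linVar := fun s r => s • w + σ r with hlin
  set dx : ℝ → R × BoundedContinuousFunction ℝ X → BoundedContinuousFunction ℝ X :=
    fun s τ => (lin s τ.1).1.2 + Q.S τ.2 with hdx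
  set dc : ℝ → R × BoundedContinuousFunction ℝ X → ℝ → C := fun s τ => (lin s τ.1).1.1 with hdc
  have hdcm : ∀ s τ, BddMeas (dc s τ) := fun s τ => (lin s τ.1).2.1
  set N := ‖w.1.2‖ + N₁ + M₁ + M₂ + ‖Q.S‖ with hN
  have hN0 : 0 ≤ N := by positivity
  have hdx_sub : ∀ s τ τ', ‖dx s τ - dx s τ'‖ ≤ N * ‖τ - τ'‖ := by
    intro s τ τ'
    have e : dx s τ - dx s τ' = (σ (τ - τ').1).1.2 + Q.S (τ - τ').2 := by
      simp [hdx, hlin]; abel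
    rw [e]
    calc _ ≤ M₂ * ‖(τ - τ').1‖ + ‖Q.S‖ * ‖(τ - τ').2‖ :=
          (norm_add_le _ _).trans (add_le_add (hσ₂ _) (Q.S.le_opNorm _))
      _ ≤ M₂ * ‖τ - τ'‖ + ‖Q.S‖ * ‖τ - τ'‖ := by
          gcongr
          · exact norm_fst_le _
          · exact norm_snd_le _
      _ = (M₂ + ‖Q.S‖) * ‖τ - τ'‖ := by ring
      _ ≤ _ := by
          gcongr
          rw [hN]
          linarith [norm_nonneg w.1.2]
  have hdc_sub : ∀ s τ τ' t, ‖dc s τ t - dc s τ' t‖ ≤ N * ‖τ - τ'‖ := by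
    intro s τ τ' t
    have e : dc s τ t - dc s τ' t = (σ (τ - τ').1).1.1 t := by
      simp [hdc, hlin]
    rw [e]
    calc _ ≤ M₁ * ‖(τ - τ').1‖ := hσ₁ _ t
      _ ≤ M₁ * ‖τ - τ'‖ := by gcongr; exact norm_fst_le _
      _ ≤ _ := by
          gcongr
          rw [hN]
          linarith [norm_nonneg w.1.2, norm_nonneg Q.S]
  have hdx0 : ∀ s, dx s 0 = s • w.1.2 := fun s => by simp [hdx, hlin]
  have hdc0 : ∀ s, dc s 0 = s • w.1.1 := fun s => by simp [hdc, hlin]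
  have hdx_le : ∀ s, 0 < s → ∀ τ, ‖τ‖ ≤ s → ‖dx s τ‖ ≤ 2 * N * s := by
    intro s hs τ hτ
    have h1 := hdx_sub s τ 0
    have h2 := norm_le_insert' (dx s τ) (dx s 0)
    have h3 : ‖dx s 0‖ ≤ s * N := by
      rw [hdx0, norm_smul, Real.norm_of_nonneg hs.le]
      gcongr
      rw [hN]
      linarith [norm_nonneg Q.S]
    rw [sub_zero] at h1
    have : N * ‖τ‖ ≤ N * s := by gcongr
    linarith
  have hdc_le : ∀ s, 0 < s → ∀ τ, ‖τ‖ ≤ s → ∀ t, ‖dc s τ t‖ ≤ 2 * N * s := by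
    intro s hs τ hτ t
    have h1 := hdc_sub s τ 0 t
    have h2 := norm_le_insert' (dc s τ t) (dc s 0 t)
    have h3 : ‖dc s 0 t‖ ≤ s * N := by
      rw [hdc0, Pi.smul_apply, norm_smul, Real.norm_of_nonneg hs.le]
      gcongr
      rw [hN]
      linarith [norm_nonneg Q.S, hN₁ t, norm_nonneg w.1.2]
    rw [sub_zero] at h1
    have : N * ‖τ‖ ≤ N * s := by gcongr
    linarith
  obtain ⟨K, hK, hlip⟩ := Q.exists_norm_remPrim_sub_le
  obtain ⟨δ, s₁, hδ, hs₁, hΛ⟩ := Q.exists_endRem_le hp w.2.1 w.1.2 hneg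
  -- Keeps the variations, of size at most `2 N s`, in the unit ball where the remainder estimates
  -- hold.
  set s₂ := min s₁ (1 / (2 * N + 1)) with hs₂
  have hs₂0 : 0 < s₂ := by positivity
  have hsmall : ∀ s, 0 < s → s < s₂ → 2 * N * s ≤ 1 := by
    intro s hs hss
    have := hss.trans_le (min_le_right _ _)
    rw [lt_div_iff₀ (by positivity)] at this
    linarith
  have hsub : ∀ s, 0 < s → s < s₂ → ∀ τ τ', ‖τ‖ ≤ s → ‖τ'‖ ≤ s →
      ‖Q.remPrim (dx s τ) (dc s τ) (hdcm s τ) - Q.remPrim (dx s τ') (dc s τ') (hdcm s τ')‖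
        ≤ K * (4 * N ^ 2) * s * ‖τ - τ'‖ ∧
      ‖Q.endRem (dx s τ) (Q.remPrim (dx s τ) (dc s τ) (hdcm s τ)) -
        Q.endRem (dx s τ') (Q.remPrim (dx s τ') (dc s τ') (hdcm s τ'))‖
        ≤ K * (4 * N ^ 2) * s * ‖τ - τ'‖ := by
    intro s hs hss τ τ' hτ hτ'
    have h := hlip (dx s τ) (dx s τ') (dc s τ) (dc s τ') (hdcm s τ) (hdcm s τ') (2 * N * s)
      (hsmall s hs hss) (hdx_le s hs τ hτ) (hdx_le s hs τ' hτ') (hdc_le s hs τ hτ)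
      (hdc_le s hs τ' hτ') (N * ‖τ - τ'‖) (hdx_sub s τ τ') (hdc_sub s τ τ')
    have hb : K * (2 * N * s) * (N * ‖τ - τ'‖) ≤ K * (4 * N ^ 2) * s * ‖τ - τ'‖ := by
      have : 0 ≤ K * N ^ 2 * s * ‖τ - τ'‖ := by positivity
      linarith
    exact ⟨h.1.trans hb, h.2.trans hb⟩
  have hzero : ∀ s, 0 < s → s < s₂ →
      ‖Q.remPrim (dx s 0) (dc s 0) (hdcm s 0)‖ ≤ K * (4 * N ^ 2) * s ^ 2 ∧
      ‖Q.endRem (dx s 0) (Q.remPrim (dx s 0) (dc s 0) (hdcm s 0))‖ ≤ K * (4 * N ^ 2) * s ^ 2 := by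
    intro s hs hss
    have hz : ‖(0 : R × BoundedContinuousFunction ℝ X)‖ ≤ s := by rw [norm_zero]; exact hs.le
    have hNs : 0 ≤ 2 * N * s := by positivity
    have h := hlip (dx s 0) 0 (dc s 0) 0 (hdcm s 0) (.const 0) (2 * N * s)
      (hsmall s hs hss) (hdx_le s hs 0 hz) (by rwa [norm_zero]) (hdc_le s hs 0 hz)
      (fun t => by rwa [Pi.zero_apply, norm_zero]) (2 * N * s)
      (by rw [sub_zero]; exact hdx_le s hs 0 hz)
      (fun t => by rw [Pi.zero_apply, sub_zero]; exact hdc_le s hs 0 hz t)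
    rw [remPrim_zero, endRem_zero, sub_zero, sub_zero] at h
    have hb : K * (2 * N * s) * (2 * N * s) = K * (4 * N ^ 2) * s ^ 2 := by ring
    rwa [hb] at h
  obtain ⟨s, hs, hsε, τ, hτ, hfix, hlt, heq⟩ := hU.exists_solution
    (fun s τ => Q.remPrim (dx s τ) (dc s τ) (hdcm s τ))
    (fun s τ => Q.endRem (dx s τ) (Q.remPrim (dx s τ) (dc s τ) (hdcm s τ)))
    (C := K * (4 * N ^ 2)) (s₀ := s₂) (δ := δ) (by positivity) hs₂0 hδ
    (fun s hs hss τ τ' hτ hτ' => (hsub s hs hss τ τ' hτ hτ').1)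
    (fun s hs hss τ τ' hτ hτ' => (hsub s hs hss τ τ' hτ hτ').2)
    (fun s hs hss => (hzero s hs hss).1) (fun s hs hss => (hzero s hs hss).2)
    -- At `τ = 0` the variation is exactly `s w`; here the negative second variation enters.
    (fun s hs hss => by
      have h := hdcm s 0
      change Λ (Q.endRem (dx s 0) (Q.remPrim (dx s 0) (dc s 0) h)) ≤ _
      revert h
      rw [hdx0, hdc0]
      exact fun h => hΛ s hs (hss.trans_le (min_le_left _ _)) (Q.bddMeas_rem _ h))
    (ε := ε / (2 * N + 1)) (by positivity)
  have hsN : 2 * N * s ≤ ε := by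
    rw [lt_div_iff₀ (by positivity)] at hsε
    linarith
  have hend := Q.g_ends_x_add hg (lin s τ.1).1.2 τ.2
  have hfv : Q.Dg (Q.ends (lin s τ.1).1.2) = (τ.1 : (ι → ℝ) × V) := by
    rw [← firstVar_apply, hlin]
    simp only [map_add, map_smul, hw, smul_zero, zero_add]
    exact hσ _
  have hy : dx s τ = (lin s τ.1).1.2 + Q.S τ.2 := rfl
  have hend2 : Q.g (Q.ends (Q.x + dx s τ)) = (τ.1 : (ι → ℝ) × V) +
      Q.endRem (dx s τ) (Q.remPrim (dx s τ) (dc s τ) (hdcm s τ)) := by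
    rw [← hfix, hy, hend, hfv]
  refine ⟨dx s τ, dc s τ, hdcm s τ, ?_, (hdx_le s hs τ hτ).trans hsN,
    fun t => (hdc_le s hs τ hτ t).trans hsN, fun i => ?_, ?_⟩
  · exact Q.isIntegralOf_x_add (lin s τ.1).2 (Q.bddMeas_rem _ (hdcm s τ)) hfix
  · rw [hend2]
    exact hlt i
  · rw [hend2]
    exact heq

end ReferenceProcess

/-! ### Concentrated control variations with negative second variation -/

theorem sq_integral_abs_le {α : Type*} [MeasurableSpace α] {μ : Measure α} [IsFiniteMeasure μ]
    {S : Set α} (hS : MeasurableSet S) (hpos : 0 < μ.real S) {ρ : α → ℝ} (hρ : ∀ t ∉ S, ρ t = 0)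
    (h1 : Integrable (fun t => |ρ t|) μ) (h2 : Integrable (fun t => ρ t ^ 2) μ) :
    (∫ t, |ρ t| ∂μ) ^ 2 ≤ μ.real S * ∫ t, ρ t ^ 2 ∂μ := by
  set N := ∫ t, |ρ t| ∂μ with hN
  set m := μ.real S with hm
  have hN0 : 0 ≤ N := integral_nonneg fun _ => abs_nonneg _
  have h20 : 0 ≤ ∫ t, ρ t ^ 2 ∂μ := integral_nonneg fun _ => sq_nonneg _
  rcases hN0.eq_or_lt with h0 | h0
  · rw [← h0]
    simp only [ne_eq, OfNat.ofNat_ne_zero, not_false_eq_true, zero_pow]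
    positivity
  have hi : Integrable (S.indicator fun _ => N ^ 2) μ :=
    (integrable_const _).indicator hS
  -- Cauchy–Schwarz by integrating `(N - m |ρ|)² ≥ 0` over `S`.
  have key : ∫ t, 2 * N * m * |ρ t| ∂μ ≤ ∫ t, (S.indicator (fun _ => N ^ 2) t + m ^ 2 * ρ t ^ 2) ∂μ :=
    integral_mono (h1.const_mul _) (hi.add (h2.const_mul _)) fun t => by
      by_cases ht : t ∈ S
      · simp only [Set.indicator_of_mem ht]
        nlinarith [sq_nonneg (N - m * |ρ t|), sq_abs (ρ t)]
      · simp [hρ t ht, Set.indicator_of_notMem ht]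
  rw [integral_const_mul, integral_add hi (h2.const_mul _), integral_const_mul,
    integral_indicator_const _ hS, ← hN, ← hm, smul_eq_mul] at key
  have : m * N ^ 2 ≤ m * (m * ∫ t, ρ t ^ 2 ∂μ) := by linarith
  exact le_of_mul_le_mul_left this hpos

namespace ReferenceProcess

variable {X C Y : Type*} [NormedAddCommGroup X] [NormedSpace ℝ X] [FiniteDimensional ℝ X]
    [NormedAddCommGroup C] [NormedSpace ℝ C] [FiniteDimensional ℝ C]
    [NormedAddCommGroup Y] [NormedSpace ℝ Y] (Q : ReferenceProcess X C Y)

/-- With zero initial value the state is `S` applied to the primitive of `B ψ`. It is the `L¹` norm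
on the right that makes the state terms negligible for variations supported on short sets. -/
theorem norm_le_of_mem_linVar {w : (ℝ → C) × BoundedContinuousFunction ℝ X} (hw : w ∈ Q.linVar)
    (h0 : w.2 0 = 0) : ‖w.2‖ ≤ ‖Q.S‖ * ∫ t, ‖Q.B t (w.1 t)‖ ∂timeMeasure Q.T := by
  have hA : BddMeas fun t => Q.A t (w.2 t) := Q.bddMeas_A.clm_apply (.of_bcf w.2)
  have hB : BddMeas fun t => Q.B t (w.1 t) := Q.bddMeas_B.clm_apply hw.1
  have e : w.2 - volterra Q.T 0 Q.A Q.bddMeas_A w.2 = prim Q.T 0 _ (hB.integrable _) := by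
    rw [sub_eq_iff_eq_add', volterra_apply, ← prim_add]
    ext t
    obtain ⟨hf, h⟩ := hw.2
    rw [h t, h0, zero_add]
    congr 2
    ext t
    exact Q.D_apply t _ _
  have hS : w.2 = Q.S (prim Q.T 0 _ (hB.integrable _)) := by
    have hu : (Q.volterraUnit : BoundedContinuousFunction ℝ X →L[ℝ] BoundedContinuousFunction ℝ X)
      = 1 - volterra Q.T 0 Q.A Q.bddMeas_A := IsUnit.unit_spec _
    have e' : (Q.volterraUnit :
        BoundedContinuousFunction ℝ X →L[ℝ] BoundedContinuousFunction ℝ X) w.2 =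
        prim Q.T 0 _ (hB.integrable _) := by
      rw [hu, sub_apply, one_apply_eq_self, e]
    rw [← e', S, ← mul_apply_eq_comp, Units.inv_mul, one_apply_eq_self]
  calc ‖w.2‖ = ‖Q.S (prim Q.T 0 _ (hB.integrable _))‖ := by rw [← hS]
    _ ≤ ‖Q.S‖ * ‖prim Q.T 0 _ (hB.integrable _)‖ := Q.S.le_opNorm _
    _ ≤ _ := by gcongr; exact norm_prim_le _ _ _

/-- Second variation along a control variation with values in a line. -/
theorem exists_secondVar_le (Λ : StrongDual ℝ Y)
    (p : BoundedContinuousFunction ℝ (StrongDual ℝ X)) (ξ : C) :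
    ∃ K, 0 ≤ K ∧ ∀ ρ : ℝ → ℝ, BddMeas ρ → ∀ y : BoundedContinuousFunction ℝ X, y 0 = 0 →
      (((fun t => ρ t • ξ), y) : (ℝ → C) × BoundedContinuousFunction ℝ X) ∈ Q.linVar →
      Q.secondVar Λ p (fun t => ρ t • ξ) y ≤ K * (∫ t, |ρ t| ∂timeMeasure Q.T) ^ 2 +
        ∫ t, ρ t ^ 2 * p t (Q.D2 t (0, ξ) (0, ξ)) ∂timeMeasure Q.T := by
  obtain ⟨MB, hMB⟩ := Q.bddMeas_B.2
  obtain ⟨M2, hM2⟩ := Q.bddMeas_D2.2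
  have hMB0 : 0 ≤ MB := (norm_nonneg _).trans (hMB 0)
  have hM20 : 0 ≤ M2 := (Q.D2 0).opNorm_nonneg.trans (hM2 0)
  have hT := Q.T_pos
  set c := ‖Q.S‖ * (MB * ‖ξ‖) with hc
  set g2 := fderiv ℝ (fderiv ℝ Q.g) (Q.ends Q.x) with hg2
  set P := ‖p‖ * M2 with hP
  -- The three terms bound the endpoint form, the state-state integral and the two mixed
  -- state-control integrals, given `‖y‖ ≤ c ∫ |ρ|`.
  refine ⟨‖Λ‖ * ‖g2‖ * c ^ 2 + (P * Q.T * c ^ 2 + 2 * P * c * ‖ξ‖), by positivity,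
    fun ρ hρ y hy0 hw => ?_⟩
  set N := ∫ t, |ρ t| ∂timeMeasure Q.T with hN
  have hN0 : 0 ≤ N := integral_nonneg fun _ => abs_nonneg _
  have hρi : Integrable (fun t => |ρ t|) (timeMeasure Q.T) := (hρ.integrable _).abs
  have hy : ‖y‖ ≤ c * N := by
    refine (Q.norm_le_of_mem_linVar hw hy0).trans ?_
    rw [hc, mul_assoc]
    gcongr
    rw [hN, ← integral_const_mul]
    refine integral_mono_of_nonneg (.of_forall fun _ => norm_nonneg _) (hρi.const_mul _)
      (.of_forall fun t => ?_)
    simp only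
    calc ‖Q.B t (ρ t • ξ)‖ ≤ MB * ‖ρ t • ξ‖ := ((Q.B t).le_opNorm _).trans (by
            gcongr; exact hMB t)
      _ = _ := by rw [norm_smul, Real.norm_eq_abs]; ring
  have hend : Λ (g2 (Q.ends y) (Q.ends y)) ≤ ‖Λ‖ * ‖g2‖ * (c * N) ^ 2 := by
    refine (le_abs_self _).trans ?_
    rw [← Real.norm_eq_abs]
    have hyb := (Q.norm_ends_le y).trans hy
    calc _ ≤ ‖Λ‖ * (‖g2‖ * ‖Q.ends y‖ * ‖Q.ends y‖) :=
          (Λ.le_opNorm _).trans (by gcongr; exact g2.le_opNorm₂ _ _)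
      _ ≤ ‖Λ‖ * (‖g2‖ * (c * N) * (c * N)) := by gcongr
      _ = _ := by ring
  have hξ : BddMeas fun t => p t (Q.D2 t (0, ξ) (0, ξ)) :=
    (BddMeas.of_bcf p).clm_apply ((Q.bddMeas_D2.clm_apply (.const _)).clm_apply (.const _))
  have hq : BddMeas fun t => ρ t ^ 2 * p t (Q.D2 t (0, ξ) (0, ξ)) := by
    simpa only [smul_eq_mul, pow_two] using (hρ.smul_fun hρ).smul_fun hξ
  have hd : BddMeas fun t => (y t, ρ t • ξ) := (BddMeas.of_bcf y).prodMk hw.1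
  have hfull : BddMeas fun t => p t (Q.D2 t (y t, ρ t • ξ) (y t, ρ t • ξ)) :=
    (BddMeas.of_bcf p).clm_apply ((Q.bddMeas_D2.clm_apply hd).clm_apply hd)
  have hb : ∀ t (a b : X × C), p t (Q.D2 t a b) ≤ P * (‖a‖ * ‖b‖) := by
    intro t a b
    refine (le_abs_self _).trans ?_
    rw [← Real.norm_eq_abs]
    calc _ ≤ ‖p‖ * (M2 * ‖a‖ * ‖b‖) := ((p t).le_opNorm _).trans (by
            gcongr
            · exact p.norm_coe_le_norm t
            · exact ((Q.D2 t).le_opNorm₂ _ _).trans (by gcongr; exact hM2 t))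
      _ = _ := by rw [hP]; ring
  have hint : ∫ t, p t (Q.D2 t (y t, ρ t • ξ) (y t, ρ t • ξ)) ∂timeMeasure Q.T ≤
      ∫ t, ((P * (c * N) ^ 2 + 2 * P * (c * N) * ‖ξ‖ * |ρ t|)
        + ρ t ^ 2 * p t (Q.D2 t (0, ξ) (0, ξ))) ∂timeMeasure Q.T := by
    refine integral_mono (hfull.integrable _)
      (((integrable_const _).add (hρi.const_mul _)).add (hq.integrable _)) fun t => ?_
    have e : ((y t, ρ t • ξ) : X × C) = (y t, 0) + ρ t • (0, ξ) := by simp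
    have hyt : ‖((y t, 0) : X × C)‖ ≤ c * N := by
      simpa using (y.norm_coe_le_norm t).trans hy
    have hξt : ‖ρ t • ((0, ξ) : X × C)‖ ≤ |ρ t| * ‖ξ‖ := by
      rw [norm_smul, Real.norm_eq_abs, Prod.norm_mk, norm_zero, max_eq_right (norm_nonneg ξ)]
    have hP0 : 0 ≤ P := by positivity
    have hcN : 0 ≤ c * N := (norm_nonneg y).trans hy
    simp only [e, map_add, add_apply]
    have h1 := (hb t (y t, 0) (y t, 0)).trans
      (mul_le_mul_of_nonneg_left (mul_le_mul hyt hyt (norm_nonneg _) hcN) hP0)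
    have h2 := (hb t (y t, 0) (ρ t • (0, ξ))).trans
      (mul_le_mul_of_nonneg_left (mul_le_mul hyt hξt (norm_nonneg _) hcN) hP0)
    have h3 := (hb t (ρ t • (0, ξ)) (y t, 0)).trans
      (mul_le_mul_of_nonneg_left (mul_le_mul hξt hyt (norm_nonneg _) (by positivity)) hP0)
    have h4 : p t (Q.D2 t (ρ t • (0, ξ)) (ρ t • (0, ξ))) =
        ρ t ^ 2 * p t (Q.D2 t (0, ξ) (0, ξ)) := by
      simp only [map_smul, smul_apply, smul_eq_mul]; ring
    rw [h4]
    linarith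
  have hint2 : ∫ t, ((P * (c * N) ^ 2 + 2 * P * (c * N) * ‖ξ‖ * |ρ t|)
        + ρ t ^ 2 * p t (Q.D2 t (0, ξ) (0, ξ))) ∂timeMeasure Q.T =
      P * (c * N) ^ 2 * Q.T + 2 * P * (c * N) * ‖ξ‖ * N
        + ∫ t, ρ t ^ 2 * p t (Q.D2 t (0, ξ) (0, ξ)) ∂timeMeasure Q.T := by
    have hi : Integrable (fun t => P * (c * N) ^ 2 + 2 * P * (c * N) * ‖ξ‖ * |ρ t|)
        (timeMeasure Q.T) := (integrable_const _).add (hρi.const_mul _)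
    rw [integral_add hi (hq.integrable _),
      integral_add (integrable_const _) (hρi.const_mul _),
      integral_const_mul (2 * P * (c * N) * ‖ξ‖) fun t => |ρ t|, ← hN]
    simp [hT.le, mul_comm]
  rw [hint2] at hint
  rw [secondVar]
  calc _ ≤ _ := add_le_add hend hint
    _ = _ := by ring

variable [FiniteDimensional ℝ Y]

open Polynomial in
/-- A nonzero polynomial times the indicator of `S`, in the direction `ξ`, annihilates the first
variation of the endpoint map. -/
theorem exists_polynomial_mem_linVar {S : Set ℝ} (hS : MeasurableSet S)
    (hSb : Bornology.IsBounded S) (ξ : C) :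
    ∃ P : ℝ[X], P ≠ 0 ∧ BddMeas (S.indicator fun t => P.eval t) ∧ ∃ w : Q.linVar,
      Q.firstVar w = 0 ∧ w.1.2 0 = 0 ∧
      w.1.1 = fun t => (S.indicator (fun t => P.eval t) t) • ξ := by
  have hmeas : ∀ P : ℝ[X], BddMeas (S.indicator fun t => P.eval t) := by
    intro P
    obtain ⟨N, hN⟩ := hSb.isCompact_closure.exists_bound_of_continuousOn
      P.continuous_aeval.continuousOn
    refine ⟨P.continuous.stronglyMeasurable.indicator hS, |N|, fun t => ?_⟩
    by_cases ht : t ∈ S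
    · rw [Set.indicator_of_mem ht]
      have := hN t (subset_closure ht)
      rw [coe_aeval_eq_eval] at this
      exact this.trans (le_abs_self N)
    · rw [Set.indicator_of_notMem ht, norm_zero]
      exact abs_nonneg N
  have hψ : ∀ k : ℕ, BddMeas fun t =>
      (S.indicator (fun t => ((Polynomial.X : ℝ[X]) ^ k).eval t) t) • ξ :=
    fun k => (hmeas _).smul_fun (.const ξ)
  choose y hy0 hy using fun k => Q.exists_mem_linVar (hψ k) 0
  set L : ℝ[X] →ₗ[ℝ] Q.linVar := Polynomial.lsum fun k =>
    LinearMap.toSpanSingleton ℝ Q.linVar ⟨_, hy k⟩ with hL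
  -- The polynomials form an infinite-dimensional space, while `Y` is finite-dimensional.
  have hnot : ¬ Function.Injective (Q.firstVar.comp L) := by
    intro hinj
    have := Module.Finite.of_injective _ hinj
    exact Polynomial.not_finite this
  obtain ⟨P, hP, hP0⟩ : ∃ P, (Q.firstVar.comp L) P = 0 ∧ P ≠ 0 := by
    by_contra hcon
    push Not at hcon
    exact hnot ((injective_iff_map_eq_zero _).2 hcon)
  have hLP : L P = P.sum fun k a => a • (⟨_, hy k⟩ : Q.linVar) := rfl
  refine ⟨P, hP0, hmeas P, L P, hP, ?_, ?_⟩
  · rw [hLP, Polynomial.sum]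
    simp only [Submodule.coe_sum, Submodule.coe_smul, Prod.snd_sum, Prod.smul_snd,
      BoundedContinuousFunction.sum_apply, BoundedContinuousFunction.smul_apply, hy0, smul_zero,
      Finset.sum_const_zero]
  · ext1 t
    rw [hLP, Polynomial.sum]
    simp only [Submodule.coe_sum, Submodule.coe_smul, Prod.fst_sum, Prod.smul_fst,
      Finset.sum_apply, Pi.smul_apply, smul_smul, ← Finset.sum_smul]
    congr 1
    by_cases ht : t ∈ S
    · simp only [Set.indicator_of_mem ht, eval_pow, eval_X]
      rw [eval_eq_sum, Polynomial.sum]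
    · simp [Set.indicator_of_notMem ht]

open Filter Topology in
theorem exists_secondVar_neg (Λ : StrongDual ℝ Y)
    (p : BoundedContinuousFunction ℝ (StrongDual ℝ X)) (ξ : C)
    (hbad : ¬ ∀ᵐ t ∂timeMeasure Q.T, 0 ≤ p t (Q.D2 t (0, ξ) (0, ξ))) :
    ∃ w : Q.linVar, Q.firstVar w = 0 ∧ Q.secondVar Λ p w.1.1 w.1.2 < 0 := by
  set h : ℝ → ℝ := fun t => p t (Q.D2 t (0, ξ) (0, ξ)) with hh
  have hhm : BddMeas h :=
    (BddMeas.of_bcf p).clm_apply ((Q.bddMeas_D2.clm_apply (.const _)).clm_apply (.const _))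
  obtain ⟨δ, hδ, hpos⟩ : ∃ δ : ℝ, 0 < δ ∧ timeMeasure Q.T {t | h t ≤ -δ} ≠ 0 := by
    by_contra hcon
    push Not at hcon
    refine hbad ?_
    have hnull : ∀ n : ℕ, ∀ᵐ t ∂timeMeasure Q.T, ¬ h t ≤ -(1 / ((n : ℝ) + 1)) := fun n => by
      rw [ae_iff]
      simpa using hcon (1 / ((n : ℝ) + 1)) (by positivity)
    filter_upwards [ae_all_iff.2 hnull] with t ht
    by_contra hneg
    push Not at hneg
    obtain ⟨n, hn⟩ := exists_nat_one_div_lt (neg_pos.2 hneg)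
    exact ht n (by linarith)
  obtain ⟨K, hK, hle⟩ := Q.exists_secondVar_le Λ p ξ
  -- As `|S| ≤ 2 r`, the state terms are at most `2 K r ∫ ρ² ≤ (δ/2) ∫ ρ²`, half of what the
  -- Legendre term provides.
  set r := δ / (4 * (K + 1)) with hr
  have hr0 : 0 < r := by positivity
  obtain ⟨x, hx, hxpos⟩ := exists_mem_forall_mem_nhdsWithin_pos_measure hpos
  set S := {t | h t ≤ -δ} ∩ Set.Ioo (x - r) (x + r) with hS
  have hSm : MeasurableSet S :=
    (measurableSet_le hhm.1.measurable measurable_const).inter measurableSet_Ioo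
  have hSpos : 0 < timeMeasure Q.T S := hxpos _ (by
    exact inter_mem_nhdsWithin _ (Ioo_mem_nhds (sub_lt_self _ hr0) (lt_add_of_pos_right _ hr0)))
  have hSreal : 0 < (timeMeasure Q.T).real S :=
    ENNReal.toReal_pos hSpos.ne' (measure_ne_top _ _)
  have hSle : (timeMeasure Q.T).real S ≤ 2 * r := by
    have h1 : timeMeasure Q.T S ≤ ENNReal.ofReal (2 * r) :=
      calc timeMeasure Q.T S ≤ volume S := Measure.restrict_apply_le _ _
        _ ≤ volume (Set.Ioo (x - r) (x + r)) := measure_mono Set.inter_subset_right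
        _ = ENNReal.ofReal (2 * r) := by rw [Real.volume_Ioo]; congr 1; ring
    exact ENNReal.toReal_le_of_le_ofReal (by positivity) h1
  obtain ⟨P, hP0, hρ, w, hw, hw0, hwψ⟩ := Q.exists_polynomial_mem_linVar hSm
    ((Metric.isBounded_Ioo _ _).subset Set.inter_subset_right) ξ
  set ρ := S.indicator fun t => P.eval t with hρdef
  have hρ2 : BddMeas fun t => ρ t ^ 2 := by
    simpa only [smul_eq_mul, pow_two] using hρ.smul_fun hρ
  refine ⟨w, hw, ?_⟩
  have hmem : (((fun t => ρ t • ξ), w.1.2) : (ℝ → C) × BoundedContinuousFunction ℝ X) ∈ Q.linVar := by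
    rw [← hwψ]
    exact w.2
  have key := hle ρ hρ w.1.2 hw0 hmem
  rw [← hwψ] at key
  have hCS := sq_integral_abs_le hSm hSreal (ρ := ρ) (fun t ht => Set.indicator_of_notMem ht _)
    (hρ.integrable _).abs (hρ2.integrable _)
  -- A nonzero polynomial has finitely many roots, so `ρ ≠ 0` almost everywhere on `S`.
  have hN2 : 0 < ∫ t, ρ t ^ 2 ∂timeMeasure Q.T := by
    rw [integral_pos_iff_support_of_nonneg (fun _ => sq_nonneg _) (hρ2.integrable _)]
    have hfin : timeMeasure Q.T (P.rootSet ℝ) = 0 :=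
      (P.rootSet_finite ℝ).measure_zero _
    rw [← measure_sdiff_null hfin] at hSpos
    refine hSpos.trans_le (measure_mono fun t ht => ?_)
    rw [Function.mem_support, hρdef, Set.indicator_of_mem ht.1]
    refine pow_ne_zero 2 fun h0 => ht.2 ?_
    rw [Polynomial.mem_rootSet]
    exact ⟨hP0, by simpa [Polynomial.coe_aeval_eq_eval] using h0⟩
  have hq : BddMeas fun t => ρ t ^ 2 * h t := by
    simpa only [smul_eq_mul] using hρ2.smul_fun hhm
  have hint : ∫ t, ρ t ^ 2 * h t ∂timeMeasure Q.T ≤ ∫ t, -δ * ρ t ^ 2 ∂timeMeasure Q.T := by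
    refine integral_mono (hq.integrable _) ((hρ2.integrable _).const_mul _) fun t => ?_
    by_cases ht : t ∈ S
    · have : h t ≤ -δ := ht.1
      nlinarith [sq_nonneg (ρ t)]
    · simp [hρdef, Set.indicator_of_notMem ht]
  rw [integral_const_mul] at hint
  set I := ∫ t, ρ t ^ 2 ∂timeMeasure Q.T with hI
  have h1 : K * (∫ t, |ρ t| ∂timeMeasure Q.T) ^ 2 ≤ K * (2 * r * I) := by
    gcongr
    exact hCS.trans (by gcongr)
  have h2 : K * (2 * r) ≤ δ / 2 := by
    rw [hr]
    have : K * (2 * (δ / (4 * (K + 1)))) = δ / 2 * (K / (K + 1)) := by field_simp; ring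
    rw [this]
    have : K / (K + 1) ≤ 1 := by rw [div_le_one (by positivity)]; linarith
    nlinarith
  have h3 : K * (2 * r * I) ≤ δ / 2 * I := by
    rw [← mul_assoc]; gcongr
  have h4 : 0 < δ * I := by positivity
  linarith

end ReferenceProcess

/-! ### Costates of functionals that annihilate the first variation -/

namespace ReferenceProcess

variable {X C Y : Type*} [NormedAddCommGroup X] [NormedSpace ℝ X] [FiniteDimensional ℝ X]
    [NormedAddCommGroup C] [NormedSpace ℝ C] [FiniteDimensional ℝ C]
    [NormedAddCommGroup Y] [NormedSpace ℝ Y] (Q : ReferenceProcess X C Y)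

theorem exists_costate (f : StrongDual ℝ Y) (hf : ∀ w, f (Q.firstVar w) = 0) :
    ∃ p : BoundedContinuousFunction ℝ (StrongDual ℝ X), Q.IsCostate f p ∧
      ∀ᵐ t ∂timeMeasure Q.T, (p t).comp (Q.B t) = 0 := by
  have := FiniteDimensional.complete ℝ X
  have hA : BddMeas fun t => -(ContinuousLinearMap.compL ℝ X X ℝ).flip (Q.A t) :=
    have := FiniteDimensional.proper_real (X →L[ℝ] X)
    Q.bddMeas_A.comp_continuous (φ := fun A => -(ContinuousLinearMap.compL ℝ X X ℝ).flip A)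
      (ContinuousLinearMap.continuous _).neg
  obtain ⟨p, hpT, hp⟩ := exists_linear_solution (a := Q.T) ⟨Q.T_pos.le, le_rfl⟩ hA (.const 0)
    ((f.comp Q.Dg).comp (ContinuousLinearMap.inr ℝ X X))
  have hp' : IsIntegralOf Q.T p fun t => -(p t).comp (Q.A t) := hp.congr fun t => by simp
  have hc : Q.IsCostate f p := by
    refine ⟨hp', fun a => ?_, fun a => by rw [hpT]; rfl⟩
    -- The costate is prescribed at `T` only; its value at `0` is read off from the uncontrolled
    -- solution with initial value `a`.
    obtain ⟨y, hy, hmem⟩ := Q.exists_mem_linVar (.const 0) a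
    have h1 := hp'.integral_pairing Q.T_pos.le hmem.2
    have h2 : ∫ t, ((-(p t).comp (Q.A t)) (y t) + p t (Q.D t (y t, 0))) ∂timeMeasure Q.T = 0 := by
      rw [← integral_zero ℝ ℝ (μ := timeMeasure Q.T)]
      congr 1
      ext t
      simp [D_apply]
    have h3 : f (Q.Dg (y 0, y Q.T)) = 0 := hf ⟨_, hmem⟩
    have h4 : p Q.T (y Q.T) - p 0 (y 0) = 0 := h1.trans h2
    have e : ((y 0, y Q.T) : X × X) = (y 0, 0) + (0, y Q.T) := by simp
    have h5 : p Q.T (y Q.T) = f (Q.Dg (0, y Q.T)) := by rw [hpT]; rfl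
    rw [e, map_add, map_add] at h3
    rw [hy] at h3 h4
    linarith
  refine ⟨p, hc, ?_⟩
  have hξ : ∀ ξ : C, ∀ᵐ t ∂timeMeasure Q.T, p t (Q.B t ξ) = 0 := by
    intro ξ
    have hr : BddMeas fun t => p t (Q.B t ξ) :=
      (BddMeas.of_bcf p).clm_apply (Q.bddMeas_B.clm_apply (.const ξ))
    -- Testing with the control `(p B ξ) ξ` gives `∫ (p B ξ)² = 0`.
    obtain ⟨y, -, hmem⟩ := Q.exists_mem_linVar (hr.smul_fun (.const ξ)) 0
    have h1 := hc.apply_ends (hmem.2.congr fun t => Q.D_apply t _ _)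
    have h2 : f (Q.Dg (Q.ends y)) = 0 := hf ⟨_, hmem⟩
    rw [h2] at h1
    have hr2 : BddMeas fun t => p t (Q.B t ξ) ^ 2 := by
      simpa only [smul_eq_mul, pow_two] using hr.smul_fun hr
    have h3 : ∫ t, p t (Q.B t ξ) ^ 2 ∂timeMeasure Q.T = 0 := by
      rw [h1]
      congr 1
      ext t
      simp only [map_smul, smul_eq_mul, pow_two]
    rw [integral_eq_zero_iff_of_nonneg (fun _ => sq_nonneg _) (hr2.integrable _)] at h3
    filter_upwards [h3] with t ht
    simpa using ht
  set b := Module.finBasis ℝ C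
  filter_upwards [ae_all_iff.2 fun i => hξ (b i)] with t ht
  ext ξ
  have : ((p t).comp (Q.B t)).toLinearMap = 0 := b.ext fun i => by simpa using ht i
  exact LinearMap.congr_fun this ξ

end ReferenceProcess

/-! ### Bounded representatives and extension by constants -/

theorem exists_bddMeas_ae_eq {W : Type*} [NormedAddCommGroup W] {T : ℝ} {f : ℝ → W}
    (hf : MemLp f ∞ (timeMeasure T)) : ∃ g, BddMeas g ∧ f =ᵐ[timeMeasure T] g := by
  set g := hf.1.mk f with hg
  have hgm : StronglyMeasurable g := hf.1.stronglyMeasurable_mk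
  have hfg : f =ᵐ[timeMeasure T] g := hf.1.ae_eq_mk
  set M := (eLpNorm f ∞ (timeMeasure T)).toReal with hM
  have hb : ∀ᵐ t ∂timeMeasure T, ‖f t‖ ≤ M := by
    filter_upwards [ae_le_eLpNormEssSup (f := f) (μ := timeMeasure T)] with t ht
    rw [← eLpNorm_exponent_top] at ht
    have := ENNReal.toReal_mono hf.2.ne ht
    rwa [toReal_enorm] at this
  refine ⟨{t | ‖g t‖ ≤ M}.indicator g, ⟨hgm.indicator
    (measurableSet_le hgm.norm.measurable measurable_const), |M|, fun t => ?_⟩, ?_⟩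
  · by_cases ht : t ∈ {t | ‖g t‖ ≤ M}
    · rw [Set.indicator_of_mem ht]
      exact le_trans ht (le_abs_self M)
    · rw [Set.indicator_of_notMem ht, norm_zero]
      exact abs_nonneg M
  · filter_upwards [hfg, hb] with t h1 h2
    have h3 : ‖g t‖ ≤ M := by rwa [← h1]
    rw [Set.indicator_of_mem (show t ∈ {t | ‖g t‖ ≤ M} from h3), h1]

theorem BddMeas.memLp_top {W : Type*} [NormedAddCommGroup W] {f : ℝ → W} (hf : BddMeas f) (T : ℝ) :
    MemLp f ∞ (timeMeasure T) := by
  obtain ⟨hf, M, hM⟩ := hf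
  exact memLp_top_of_bound hf.aestronglyMeasurable M (.of_forall hM)

theorem exists_bcf_eq_comp_clampTime {W : Type*} [NormedAddCommGroup W] {T : ℝ} (hT : 0 ≤ T)
    {h : ℝ → W} {K : NNReal} (hh : LipschitzOnWith K h (Set.Icc 0 T)) :
    ∃ x : BoundedContinuousFunction ℝ W, ∀ t, x t = h (clampTime T t) := by
  obtain ⟨M, hM⟩ := isCompact_Icc.exists_bound_of_continuousOn hh.continuousOn
  have hc : Continuous (clampTime T) := by unfold clampTime; fun_prop
  exact ⟨BoundedContinuousFunction.ofNormedAddCommGroup (fun t => h (clampTime T t))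
    (hh.continuousOn.comp_continuous hc (clampTime_mem hT)) M
    fun t => hM _ (clampTime_mem hT t), fun t => rfl⟩

theorem clampTime_of_mem {T t : ℝ} (ht : t ∈ Set.Icc 0 T) : clampTime T t = t := by
  rw [clampTime, min_eq_left ht.2, max_eq_right ht.1]

theorem isIntegralOf_of_eq_comp_clampTime {W : Type*} [NormedAddCommGroup W] [NormedSpace ℝ W]
    [CompleteSpace W] {T : ℝ} (hT : 0 ≤ T)
    {h : ℝ → W} {K : NNReal} (hh : LipschitzOnWith K h (Set.Icc 0 T))
    {x : BoundedContinuousFunction ℝ W} (hx : ∀ t, x t = h (clampTime T t)) {f : ℝ → W}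
    (hf : BddMeas f) (hd : ∀ᵐ t ∂timeMeasure T, HasDerivAt h (f t) t) : IsIntegralOf T x f := by
  refine isIntegralOf_of_eq (a := 0) (c := h 0) hf fun t => ?_
  rw [hx, eq_add_integral_of_lipschitzOnWith hT hh hf hd (clampTime_mem hT t), prim_clampTime hT]

/-! ### Translation between the optimal control problem and reference processes -/

namespace PartiallyAffine

namespace Problem

variable {n l m dφ dη : ℕ} (P : Problem n l m dφ dη)

/-- The dynamics as a function of the state and of the pair of controls. -/
def dyn (z : E n × (E l × E m)) : E n := P.F z.1 z.2.1 z.2.2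

/-- The endpoint constraints and the excess of the cost over its value at `e`. -/
noncomputable def endMap (e q : E n × E n) : (Fin (dφ + 1) → ℝ) × (Fin dη → ℝ) :=
  (fun i => P.φ i q - P.φ i e, fun j => P.η j q)

variable {P}

theorem Regular.contDiff_dyn (h : P.Regular) : ContDiff ℝ 2 P.dyn := by
  unfold dyn F
  refine ContDiff.sum fun i _ => ContDiff.fun_smul ?_ ?_
  · refine Fin.cases ?_ (fun k => ?_) i
    · simp only [Fin.cons_zero]
      exact contDiff_const
    · simp only [Fin.cons_succ]
      fun_prop
  · exact (h.1 i).1.comp (by fun_prop)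

theorem Regular.contDiff_endMap (h : P.Regular) (e : E n × E n) : ContDiff ℝ 2 (P.endMap e) := by
  unfold endMap
  refine ContDiff.prodMk (contDiff_pi.2 fun i => ?_) (contDiff_pi.2 fun j => (h.2.2 j).1)
  exact (h.2.1 i).1.sub contDiff_const

/-- The functional on the values of the endpoint map given by the multipliers `α, β`. -/
noncomputable def endFunctional (α : Fin (dφ + 1) → ℝ) (β : Fin dη → ℝ) :
    StrongDual ℝ ((Fin (dφ + 1) → ℝ) × (Fin dη → ℝ)) :=
  ∑ i, α i • (ContinuousLinearMap.proj i).comp (ContinuousLinearMap.fst ℝ _ _) +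
    ∑ j, β j • (ContinuousLinearMap.proj j).comp (ContinuousLinearMap.snd ℝ _ _)

theorem endFunctional_apply (α : Fin (dφ + 1) → ℝ) (β : Fin dη → ℝ)
    (y : (Fin (dφ + 1) → ℝ) × (Fin dη → ℝ)) :
    endFunctional α β y = ∑ i, α i * y.1 i + ∑ j, β j * y.2 j := by
  simp [endFunctional]

theorem eq_endFunctional (f : StrongDual ℝ ((Fin (dφ + 1) → ℝ) × (Fin dη → ℝ))) :
    f = endFunctional (fun i => f (Pi.single i 1, 0)) (fun j => f (0, Pi.single j 1)) := by
  have hsingle : ∀ {k : ℕ} (i : Fin k), (fun j => if i = j then (1 : ℝ) else 0) = Pi.single i 1 :=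
    fun i => by
      ext j
      simp [Pi.single_apply, eq_comm]
  refine ContinuousLinearMap.ext fun y => ?_
  have h1 := (f.comp (ContinuousLinearMap.inl ℝ _ _)).toLinearMap.pi_apply_eq_sum_univ y.1
  have h2 := (f.comp (ContinuousLinearMap.inr ℝ _ _)).toLinearMap.pi_apply_eq_sum_univ y.2
  simp only [hsingle, ContinuousLinearMap.coe_coe, ContinuousLinearMap.comp_apply,
    ContinuousLinearMap.inl_apply, ContinuousLinearMap.inr_apply, smul_eq_mul] at h1 h2
  have h3 : f y = f (y.1, 0) + f (0, y.2) := by rw [← map_add]; simp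
  rw [h3, h1, h2, endFunctional_apply]
  simp only [mul_comm]

theorem ell_eq (lam : Triple n dφ dη) (e q : E n × E n) :
    P.ell lam q = endFunctional lam.α lam.β (P.endMap e q) + ∑ i, lam.α i * P.φ i e := by
  rw [endFunctional_apply]
  simp only [ell, endMap, mul_sub, Finset.sum_sub_distrib]
  ring

/-- The insertion `c` is kept general so that the derivatives in `x`, `u` and `v` are instances of
one chain rule. -/
theorem Regular.hasFDerivAt_H (h : P.Regular) (lam : Triple n dφ dη) (t : ℝ)
    {Z : Type*} [NormedAddCommGroup Z] [NormedSpace ℝ Z] {c : Z → E n × (E l × E m)}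
    {c' : Z →L[ℝ] E n × (E l × E m)} {z : Z} (hc : HasFDerivAt c c' z) :
    HasFDerivAt (fun z => P.H lam (c z).1 (c z).2.1 (c z).2.2 t)
      ((lam.p t).comp ((fderiv ℝ P.dyn (c z)).comp c')) z := by
  have h1 : HasFDerivAt P.dyn (fderiv ℝ P.dyn (c z)) (c z) :=
    (h.contDiff_dyn.differentiable (by norm_num) _).hasFDerivAt
  exact (lam.p t).hasFDerivAt.comp z (h1.comp z hc)

theorem Regular.fderiv_H_x (h : P.Regular) (lam : Triple n dφ dη) (t : ℝ) (x : E n) (u : E l)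
    (v : E m) : fderiv ℝ (fun y => P.H lam y u v t) x =
      (lam.p t).comp ((fderiv ℝ P.dyn (x, (u, v))).comp (ContinuousLinearMap.inl ℝ _ _)) :=
  (h.hasFDerivAt_H lam t (hasFDerivAt_prodMk_left x (u, v))).fderiv

theorem Regular.fderiv_H_u (h : P.Regular) (lam : Triple n dφ dη) (t : ℝ) (x : E n) (u : E l)
    (v : E m) : fderiv ℝ (fun a => P.H lam x a v t) u =
      (lam.p t).comp ((fderiv ℝ P.dyn (x, (u, v))).comp ((ContinuousLinearMap.inr ℝ _ _).comp
        (ContinuousLinearMap.inl ℝ _ _))) :=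
  (h.hasFDerivAt_H lam t (HasFDerivAt.comp (g := fun c : E l × E m => (x, c)) u
    (hasFDerivAt_prodMk_right x (u, v)) (hasFDerivAt_prodMk_left u v))).fderiv

theorem Regular.fderiv_H_v (h : P.Regular) (lam : Triple n dφ dη) (t : ℝ) (x : E n) (u : E l)
    (v : E m) : fderiv ℝ (fun b => P.H lam x u b t) v =
      (lam.p t).comp ((fderiv ℝ P.dyn (x, (u, v))).comp ((ContinuousLinearMap.inr ℝ _ _).comp
        (ContinuousLinearMap.inr ℝ _ _))) :=
  (h.hasFDerivAt_H lam t (HasFDerivAt.comp (g := fun c : E l × E m => (x, c)) v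
    (hasFDerivAt_prodMk_right x (u, v)) (hasFDerivAt_prodMk_right u v))).fderiv

theorem Regular.hasFDerivAt_ell (h : P.Regular) (lam : Triple n dφ dη) (e : E n × E n)
    {c : E n → E n × E n} {c' : E n →L[ℝ] E n × E n} {z : E n} (hc : HasFDerivAt c c' z) :
    HasFDerivAt (fun z => P.ell lam (c z))
      ((endFunctional lam.α lam.β).comp ((fderiv ℝ (P.endMap e) (c z)).comp c')) z := by
  have h1 : HasFDerivAt (P.endMap e) (fderiv ℝ (P.endMap e) (c z)) (c z) :=
    ((h.contDiff_endMap e).differentiable (by norm_num) _).hasFDerivAt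
  simp only [ell_eq lam e]
  exact ((endFunctional lam.α lam.β).hasFDerivAt.comp z (h1.comp z hc)).add_const _

theorem Regular.fderiv_ell_left (h : P.Regular) (lam : Triple n dφ dη) (e : E n × E n)
    (a b : E n) : fderiv ℝ (fun a => P.ell lam (a, b)) a =
      (endFunctional lam.α lam.β).comp
        ((fderiv ℝ (P.endMap e) (a, b)).comp (ContinuousLinearMap.inl ℝ _ _)) :=
  (h.hasFDerivAt_ell lam e (hasFDerivAt_prodMk_left a b)).fderiv

theorem Regular.fderiv_ell_right (h : P.Regular) (lam : Triple n dφ dη) (e : E n × E n)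
    (a b : E n) : fderiv ℝ (fun b => P.ell lam (a, b)) b =
      (endFunctional lam.α lam.β).comp
        ((fderiv ℝ (P.endMap e) (a, b)).comp (ContinuousLinearMap.inr ℝ _ _)) :=
  (h.hasFDerivAt_ell lam e (hasFDerivAt_prodMk_right a b)).fderiv

/-- A reference process that represents the trajectory `w` of `P`. -/
structure Represents (P : Problem n l m dφ dη) (w : StateControl n l m)
    (Q : ReferenceProcess (E n) (E l × E m) ((Fin (dφ + 1) → ℝ) × (Fin dη → ℝ))) : Prop where
  T_eq : Q.T = P.T
  G_eq : Q.G = P.dyn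
  g_eq : Q.g = P.endMap (P.endpoints w)
  x_eq : Set.EqOn Q.x w.x (Set.Icc 0 P.T)
  c_eq : ∀ᵐ t ∂timeMeasure P.T, Q.c t = (w.u t, w.v t)

theorem IsTrajectory.exists_represents (hT : 0 < P.T) (h : P.Regular) {w : StateControl n l m}
    (hw : P.IsTrajectory w) : ∃ Q, P.Represents w Q := by
  obtain ⟨K, hK⟩ := hw.memX
  obtain ⟨x, hx⟩ := exists_bcf_eq_comp_clampTime hT.le hK
  obtain ⟨u, hu, huw⟩ := exists_bddMeas_ae_eq hw.memU
  obtain ⟨v, hv, hvw⟩ := exists_bddMeas_ae_eq hw.memV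
  have hc : BddMeas fun t => (u t, v t) := hu.prodMk hv
  have hxeq : Set.EqOn x w.x (Set.Icc 0 P.T) := fun t ht => by rw [hx, clampTime_of_mem ht]
  have hceq : ∀ᵐ t ∂timeMeasure P.T, (u t, v t) = (w.u t, w.v t) := by
    filter_upwards [huw, hvw] with t h1 h2
    rw [h1, h2]
  have hf : BddMeas fun t => P.dyn (x t, (u t, v t)) :=
    ((BddMeas.of_bcf x).prodMk hc).comp_continuous h.contDiff_dyn.continuous
  refine ⟨⟨P.T, hT, P.dyn, h.contDiff_dyn, P.endMap (P.endpoints w), h.contDiff_endMap _, x, _, hc,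
    isIntegralOf_of_eq_comp_clampTime hT.le hK hx hf ?_⟩, rfl, rfl, rfl, hxeq, hceq⟩
  filter_upwards [hw.state, hceq, ae_restrict_mem measurableSet_Icc] with t h1 h2 h3
  rw [h2, hxeq h3]
  exact h1

namespace Represents

variable {w : StateControl n l m}
  {Q : ReferenceProcess (E n) (E l × E m) ((Fin (dφ + 1) → ℝ) × (Fin dη → ℝ))}

theorem ends_x (hQ : P.Represents w Q) : Q.ends Q.x = P.endpoints w := by
  have hT : 0 ≤ P.T := hQ.T_eq ▸ Q.T_pos.le
  rw [ReferenceProcess.ends_apply, hQ.T_eq, hQ.x_eq ⟨le_rfl, hT⟩, hQ.x_eq ⟨hT, le_rfl⟩]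
  rfl

theorem ae_base (hQ : P.Represents w Q) :
    ∀ᵐ t ∂timeMeasure P.T, Q.base t = (w.x t, (w.u t, w.v t)) := by
  filter_upwards [hQ.c_eq, ae_restrict_mem measurableSet_Icc] with t h1 h2
  rw [ReferenceProcess.base, h1, hQ.x_eq h2]

theorem Dg_eq (hQ : P.Represents w Q) :
    Q.Dg = fderiv ℝ (P.endMap (P.endpoints w)) (w.x 0, w.x P.T) := by
  rw [ReferenceProcess.Dg, hQ.ends_x, hQ.g_eq]
  rfl

theorem exists_isMultiplier (hQ : P.Represents w Q) (h : P.Regular) {α : Fin (dφ + 1) → ℝ}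
    {β : Fin dη → ℝ} (hα : ∀ i, 0 ≤ α i) (hsum : ∑ i, |α i| + ∑ j, |β j| = 1)
    (hf : ∀ r, endFunctional α β (Q.firstVar r) = 0) : ∃ p, P.IsMultiplier w ⟨α, β, p⟩ := by
  obtain ⟨p, hp, hB⟩ := Q.exists_costate _ hf
  have hT : 0 ≤ P.T := hQ.T_eq ▸ Q.T_pos.le
  have hint := hp.isIntegralOf
  rw [hQ.T_eq] at hint hB
  refine ⟨p, hint.lipschitzOnWith, hsum, hα, ?_, ?_, ?_, ?_, ?_⟩
  · filter_upwards [hint.ae_hasDerivAt hT, hQ.ae_base] with t h1 h2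
    rw [h.fderiv_H_x]
    rw [ReferenceProcess.A, ReferenceProcess.D, h2, hQ.G_eq] at h1
    exact h1
  · rw [h.fderiv_ell_left _ (P.endpoints w)]
    ext a
    have := hp.zero a
    rw [hQ.Dg_eq] at this
    simpa using this
  · rw [h.fderiv_ell_right _ (P.endpoints w)]
    ext a
    have := hp.final a
    rw [hQ.Dg_eq, hQ.T_eq] at this
    simpa using this
  · filter_upwards [hB, hQ.ae_base] with t h1 h2
    rw [h.fderiv_H_u]
    rw [ReferenceProcess.B, ReferenceProcess.D, h2, hQ.G_eq] at h1
    ext a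
    have := congrArg (fun k : StrongDual ℝ (E l × E m) => k (a, 0)) h1
    simpa using this
  · filter_upwards [hB, hQ.ae_base] with t h1 h2
    rw [h.fderiv_H_v]
    rw [ReferenceProcess.B, ReferenceProcess.D, h2, hQ.G_eq] at h1
    ext a
    have := congrArg (fun k : StrongDual ℝ (E l × E m) => k (0, a)) h1
    simpa using this

/-- Divided by the sum of the absolute values of its coefficients, a normal satisfies the
normalization of a multiplier, and a costate exists for it. Uniqueness then identifies its
coefficients with those of `lam`. -/
theorem isUniqueNormal (hQ : P.Represents w Q) (h : P.Regular) {lam : Triple n dφ dη}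
    (hlam : P.IsUniqueMultiplier w lam) :
    IsUniqueNormal (LinearMap.range Q.firstVar) (endFunctional lam.α lam.β) := by
  intro f hf0 hfR hfpos
  set α := fun i => f (Pi.single i 1, 0) with hα
  set β := fun j => f (0, Pi.single j 1) with hβ
  have hf : f = endFunctional α β := eq_endFunctional f
  set c := ∑ i, |α i| + ∑ j, |β j| with hc
  have hα0 : 0 ≤ ∑ i, |α i| := Finset.sum_nonneg fun _ _ => abs_nonneg _
  have hβ0 : 0 ≤ ∑ j, |β j| := Finset.sum_nonneg fun _ _ => abs_nonneg _
  have hc0 : 0 < c := by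
    refine lt_of_le_of_ne (add_nonneg hα0 hβ0) fun h0 => hf0 ?_
    have h1 : ∑ i, |α i| = 0 := by linarith
    have h2 : ∑ j, |β j| = 0 := by linarith
    rw [Finset.sum_eq_zero_iff_of_nonneg fun _ _ => abs_nonneg _] at h1 h2
    rw [hf]
    ext y
    · simp [endFunctional_apply, fun i => abs_eq_zero.1 (h1 i (Finset.mem_univ i))]
    · simp [endFunctional_apply, fun j => abs_eq_zero.1 (h2 j (Finset.mem_univ j))]
  have hscale : f = c • endFunctional (fun i => c⁻¹ * α i) (fun j => c⁻¹ * β j) := by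
    rw [hf]
    refine ContinuousLinearMap.ext fun y => ?_
    simp only [smul_apply, endFunctional_apply, smul_eq_mul, mul_assoc, ← Finset.mul_sum,
      ← mul_add]
    rw [mul_inv_cancel_left₀ hc0.ne']
  obtain ⟨p, hp⟩ := hQ.exists_isMultiplier h (α := fun i => c⁻¹ * α i) (β := fun j => c⁻¹ * β j)
    (fun i => mul_nonneg (inv_nonneg.2 hc0.le) (hfpos i))
    (by
      simp only [abs_mul, ← Finset.mul_sum, ← mul_add, abs_inv, abs_of_pos hc0]
      rw [← hc, inv_mul_cancel₀ hc0.ne'])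
    (fun r => by
      have h1 := hfR _ ⟨r, rfl⟩
      rw [hscale, smul_apply, smul_eq_mul] at h1
      exact (mul_eq_zero.1 h1).resolve_left hc0.ne')
  obtain ⟨e1, e2, -⟩ := hlam.2 _ hp
  refine ⟨c, hc0, ?_⟩
  rw [← e1, ← e2]
  exact hscale

theorem exists_isCostate (hQ : P.Represents w Q) (h : P.Regular) {lam : Triple n dφ dη}
    (hlam : P.IsMultiplier w lam) :
    ∃ p, Q.IsCostate (endFunctional lam.α lam.β) p ∧ Set.EqOn p lam.p (Set.Icc 0 P.T) := by
  have hT : 0 ≤ P.T := hQ.T_eq ▸ Q.T_pos.le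
  obtain ⟨K, hK⟩ := hlam.memP
  obtain ⟨p, hp⟩ := exists_bcf_eq_comp_clampTime hT hK
  have hpeq : Set.EqOn p lam.p (Set.Icc 0 P.T) := fun t ht => by rw [hp, clampTime_of_mem ht]
  refine ⟨p, ⟨?_, fun a => ?_, fun a => ?_⟩, hpeq⟩
  · rw [hQ.T_eq]
    refine isIntegralOf_of_eq_comp_clampTime hT hK hp
      ((BddMeas.of_bcf p).clm_comp Q.bddMeas_A).neg ?_
    filter_upwards [hlam.costate, hQ.ae_base, ae_restrict_mem measurableSet_Icc] with t h1 h2 h3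
    rw [h.fderiv_H_x] at h1
    rw [ReferenceProcess.A, ReferenceProcess.D, h2, hQ.G_eq, hpeq h3]
    exact h1
  · rw [hpeq ⟨le_rfl, hT⟩, hlam.transv_zero, h.fderiv_ell_left _ (P.endpoints w), hQ.Dg_eq]
    simp
  · rw [hQ.T_eq, hpeq ⟨hT, le_rfl⟩, hlam.transv_T, h.fderiv_ell_right _ (P.endpoints w), hQ.Dg_eq]
    simp

end Represents

variable {w : StateControl n l m}

theorem normInf_lt_ofReal {Y : Type*} [NormedAddCommGroup Y] {T ε : ℝ} {h : ℝ → Y} (hε : 0 < ε)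
    (hh : ∀ᵐ t ∂timeMeasure T, ‖h t‖ ≤ ε / 2) : normInf T h < ENNReal.ofReal ε := by
  refine lt_of_le_of_lt (b := ENNReal.ofReal (ε / 2)) ?_
    ((ENNReal.ofReal_lt_ofReal_iff hε).2 (half_lt_self hε))
  rw [normInf, eLpNorm_exponent_top]
  refine eLpNormEssSup_le_of_ae_bound hh

theorem Represents.isTrajectory
    {Q : ReferenceProcess (E n) (E l × E m) ((Fin (dφ + 1) → ℝ) × (Fin dη → ℝ))}
    (hQ : P.Represents w Q) {x : BoundedContinuousFunction ℝ (E n)} {c : ℝ → E l × E m}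
    (hc : BddMeas c) (hx : IsIntegralOf Q.T x fun t => Q.G (x t, c t)) :
    P.IsTrajectory ⟨x, fun t => (c t).1, fun t => (c t).2⟩ := by
  rw [hQ.T_eq, hQ.G_eq] at hx
  exact ⟨hx.lipschitzOnWith, (hc.comp_continuous continuous_fst).memLp_top _,
    (hc.comp_continuous continuous_snd).memLp_top _, hx.ae_hasDerivAt (hQ.T_eq ▸ Q.T_pos.le)⟩

theorem IsWeakMin.ae_nonneg_apply_D2 (hmin : P.IsWeakMin w) (hreg : P.Regular)
    (hact : ∀ i : Fin dφ, P.φ i.succ (P.endpoints w) = 0) {lam : Triple n dφ dη}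
    (hlam : P.IsUniqueMultiplier w lam)
    {Q : ReferenceProcess (E n) (E l × E m) ((Fin (dφ + 1) → ℝ) × (Fin dη → ℝ))}
    (hQ : P.Represents w Q) {p : BoundedContinuousFunction ℝ (EDual n)}
    (hp : Q.IsCostate (endFunctional lam.α lam.β) p) (ξ : E l × E m) :
    ∀ᵐ t ∂timeMeasure Q.T, 0 ≤ p t (Q.D2 t (0, ξ) (0, ξ)) := by
  by_contra hbad
  obtain ⟨hfeas, ε, hε, hopt⟩ := hmin
  obtain ⟨r, hr0, hrneg⟩ := Q.exists_secondVar_neg (endFunctional lam.α lam.β) p ξ hbad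
  have hg : Q.g (Q.ends Q.x) = 0 := by
    rw [hQ.ends_x, hQ.g_eq]
    ext i
    · simp [endMap]
    · exact hfeas.eq_constr i
  obtain ⟨y, κ, hκ, hint, hy, hκε, hneg, hzero⟩ := Q.exists_improvement hg
    (hQ.isUniqueNormal hreg hlam) hp r hr0 hrneg (half_pos hε)
  have htraj := hQ.isTrajectory (Q.bddMeas_c.add hκ) hint
  set w' : StateControl n l m := ⟨Q.x + y, fun t => (Q.c t + κ t).1, fun t => (Q.c t + κ t).2⟩
    with hw'
  have hends : Q.ends (Q.x + y) = P.endpoints w' := by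
    rw [ReferenceProcess.ends_apply, hQ.T_eq]
    rfl
  rw [hends, hQ.g_eq] at hneg hzero
  -- Every `φᵢ` strictly decreases. For `i ≥ 1` the reference value is zero by activity, so `w'` is
  -- feasible; `i = 0` contradicts optimality.
  have hlt : ∀ i, P.φ i (P.endpoints w') < P.φ i (P.endpoints w) := fun i => sub_neg.1 (hneg i)
  have hfeas' : P.IsFeasible w' :=
    ⟨htraj, fun j => congrFun hzero j, fun i => ((hlt i.succ).trans_eq (hact i)).le⟩
  have hc := hQ.c_eq
  refine (hopt w' hfeas' (normInf_lt_ofReal hε ?_) (normInf_lt_ofReal hε ?_)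
    (normInf_lt_ofReal hε ?_)).not_gt (hlt 0)
  · filter_upwards [ae_restrict_mem measurableSet_Icc] with t ht
    have : (w'.x - w.x) t = y t := by
      simp [hw', hQ.x_eq ht]
    rw [this]
    exact (y.norm_coe_le_norm t).trans hy
  · filter_upwards [hc] with t ht
    have : (w'.u - w.u) t = (κ t).1 := by
      simp [hw', ht]
    rw [this]
    exact (norm_fst_le _).trans (hκε t)
  · filter_upwards [hc] with t ht
    have : (w'.v - w.v) t = (κ t).2 := by
      simp [hw', ht]
    rw [this]
    exact (norm_snd_le _).trans (hκε t)

/-- The exceptional null set depends on `ξ`; a countable dense set of directions and continuity in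
`ξ` make it common to all. -/
theorem IsWeakMin.ae_forall_nonneg (hT : 0 < P.T) (hmin : P.IsWeakMin w) (hreg : P.Regular)
    (hact : ∀ i : Fin dφ, P.φ i.succ (P.endpoints w) = 0) {lam : Triple n dφ dη}
    (hlam : P.IsUniqueMultiplier w lam) :
    ∀ᵐ t ∂timeMeasure P.T, ∀ ξ : E l × E m,
      0 ≤ lam.p t (fderiv ℝ (fderiv ℝ P.dyn) (w.x t, (w.u t, w.v t)) (0, ξ) (0, ξ)) := by
  obtain ⟨Q, hQ⟩ := hmin.1.toIsTrajectory.exists_represents hT hreg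
  obtain ⟨p, hp, hpeq⟩ := hQ.exists_isCostate hreg hlam.1
  have h := fun k => hmin.ae_nonneg_apply_D2 hreg hact hlam hQ hp
    (TopologicalSpace.denseSeq (E l × E m) k)
  rw [← ae_all_iff, hQ.T_eq] at h
  filter_upwards [h, hQ.ae_base, ae_restrict_mem measurableSet_Icc] with t h1 h2 h3 ξ
  rw [← h2, ← hQ.G_eq, ← hpeq h3]
  have hcl : IsClosed {ξ : E l × E m | 0 ≤ p t (Q.D2 t (0, ξ) (0, ξ))} :=
    isClosed_le continuous_const (by fun_prop)
  have : closure (Set.range (TopologicalSpace.denseSeq (E l × E m))) ⊆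
      {ξ : E l × E m | 0 ≤ p t (Q.D2 t (0, ξ) (0, ξ))} :=
    hcl.closure_subset_iff.2 (Set.range_subset_iff.2 h1)
  rw [(TopologicalSpace.denseRange_denseSeq _).closure_range] at this
  exact this (Set.mem_univ ξ)

/-- The second derivative of the pre-Hamiltonian in the controls along `w`. -/
noncomputable def hessForm (P : Problem n l m dφ dη) (w : StateControl n l m) (lam : Triple n dφ dη)
    (t : ℝ) (ξ ζ : E l × E m) : ℝ :=
  lam.p t (fderiv ℝ (fderiv ℝ P.dyn) (w.x t, (w.u t, w.v t)) (0, ξ) (0, ζ))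

/-! ### Hessian of the pre-Hamiltonian in the controls -/

theorem Regular.hasFDerivAt_fderiv_dyn (h : P.Regular) {Z : Type*} [NormedAddCommGroup Z]
    [NormedSpace ℝ Z] {c : Z → E n × (E l × E m)} {c' : Z →L[ℝ] E n × (E l × E m)} {z : Z}
    (hc : HasFDerivAt c c' z) (p : EDual n) (ζ : E n × (E l × E m)) :
    HasFDerivAt (fun z => p (fderiv ℝ P.dyn (c z) ζ))
      (p.comp (((fderiv ℝ (fderiv ℝ P.dyn) (c z)).flip ζ).comp c')) z := by
  have h1 : HasFDerivAt (fderiv ℝ P.dyn) (fderiv ℝ (fderiv ℝ P.dyn) (c z)) (c z) :=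
    ((h.contDiff_dyn.fderiv_right (m := 1) (by norm_num)).differentiable (by norm_num)
      _).hasFDerivAt
  have h2 := (h1.comp z hc).clm_apply (hasFDerivAt_const ζ z)
  refine (p.hasFDerivAt.comp z h2).congr_fderiv ?_
  ext k
  simp

/-- The insertion `c` has constant derivative, so no second derivative of `c` appears. -/
theorem Regular.fderiv_fderiv_apply (h : P.Regular) {Z : Type*} [NormedAddCommGroup Z]
    [NormedSpace ℝ Z] {c : Z → E n × (E l × E m)} {c' : Z →L[ℝ] E n × (E l × E m)}
    (hc : ∀ z, HasFDerivAt c c' z) (lam : Triple n dφ dη) (t : ℝ) (z ξ ζ : Z) :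
    fderiv ℝ (fderiv ℝ fun z => P.H lam (c z).1 (c z).2.1 (c z).2.2 t) z ξ ζ =
      lam.p t (fderiv ℝ (fderiv ℝ P.dyn) (c z) (c' ξ) (c' ζ)) := by
  have h1 : fderiv ℝ (fun z => P.H lam (c z).1 (c z).2.1 (c z).2.2 t) =
      fun z => (lam.p t).comp ((fderiv ℝ P.dyn (c z)).comp c') :=
    funext fun z => (h.hasFDerivAt_H lam t (hc z)).fderiv
  have h2 : DifferentiableAt ℝ (fderiv ℝ P.dyn) (c z) :=
    (h.contDiff_dyn.fderiv_right (m := 1) (by norm_num)).differentiable (by norm_num) _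
  have h3 : DifferentiableAt ℝ (fun z => (lam.p t).comp ((fderiv ℝ P.dyn (c z)).comp c')) z :=
    (differentiableAt_const _).clm_comp
      ((h2.comp z (hc z).differentiableAt).clm_comp (differentiableAt_const _))
  have h4 := (h3.hasFDerivAt.clm_apply (hasFDerivAt_const ζ z)).unique
    (h.hasFDerivAt_fderiv_dyn (hc z) (lam.p t) (c' ζ))
  rw [h1]
  simpa using congrArg (fun k : StrongDual ℝ Z => k ξ) h4

theorem Regular.hessUV_apply (h : P.Regular) (lam : Triple n dφ dη) (t : ℝ) (i j : Fin l ⊕ Fin m) :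
    P.hessUV w lam t i j = P.hessForm w lam t
      (Sum.elim (fun i => (e i, 0)) (fun k => (0, e k)) i)
      (Sum.elim (fun i => (e i, 0)) (fun k => (0, e k)) j) :=
  h.fderiv_fderiv_apply (fun z => hasFDerivAt_prodMk_right (w.x t) z) lam t _ _ _

theorem Regular.Huu_apply (h : P.Regular) (lam : Triple n dφ dη) (t : ℝ) (i j : Fin l) :
    P.Huu w lam t i j = P.hessForm w lam t (e i, 0) (e j, 0) :=
  h.fderiv_fderiv_apply (fun a => HasFDerivAt.comp (g := fun c : E l × E m => (w.x t, c)) a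
    (hasFDerivAt_prodMk_right (w.x t) (a, w.v t)) (hasFDerivAt_prodMk_left a (w.v t))) lam t _ _ _

theorem Regular.Hvu_apply (h : P.Regular) (lam : Triple n dφ dη) (t : ℝ) (i : Fin m) (j : Fin l) :
    P.Hvu w lam t i j = P.hessForm w lam t (0, e i) (e j, 0) := by
  simp only [Hvu, Matrix.of_apply, h.fderiv_H_u]
  exact congrArg (fun k : StrongDual ℝ (E m) => k (e i))
    (h.hasFDerivAt_fderiv_dyn (HasFDerivAt.comp (g := fun c : E l × E m => (w.x t, c)) (w.v t)
      (hasFDerivAt_prodMk_right (w.x t) (w.u t, w.v t))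
      (hasFDerivAt_prodMk_right (w.u t) (w.v t))) (lam.p t) (0, (e j, 0))).fderiv

theorem Regular.hessForm_comm (h : P.Regular) (lam : Triple n dφ dη) (t : ℝ) (ξ ζ : E l × E m) :
    P.hessForm w lam t ξ ζ = P.hessForm w lam t ζ ξ := by
  have := (h.contDiff_dyn.contDiffAt (x := (w.x t, (w.u t, w.v t)))).isSymmSndFDerivAt (by simp)
  rw [hessForm, this, ← hessForm]

theorem hessForm_sum (lam : Triple n dφ dη) (t : ℝ) {ι : Type*} [Fintype ι] (c : ι → ℝ)
    (b : ι → E l × E m) : P.hessForm w lam t (∑ i, c i • b i) (∑ i, c i • b i) =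
      ∑ i, c i * ∑ j, P.hessForm w lam t (b i) (b j) * c j := by
  have h : ((0 : E n), ∑ i, c i • b i) = ∑ i, c i • ((0 : E n), b i) := by
    simp [Prod.ext_iff, Prod.fst_sum, Prod.snd_sum]
  simp only [hessForm, h, map_sum, map_smul, sum_apply, smul_apply, smul_eq_mul, Finset.mul_sum]
  rw [Finset.sum_comm]
  refine Finset.sum_congr rfl fun i _ => Finset.sum_congr rfl fun j _ => by ring

/-- The dynamics are affine in the second control. -/
theorem Regular.hessForm_snd_snd (h : P.Regular) (lam : Triple n dφ dη) (t : ℝ) (ξ ζ : E m) :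
    P.hessForm w lam t (0, ξ) (0, ζ) = 0 := by
  have h1 := h.fderiv_fderiv_apply (fun b => HasFDerivAt.comp
    (g := fun c : E l × E m => (w.x t, c)) b
    (hasFDerivAt_prodMk_right (w.x t) (w.u t, b)) (hasFDerivAt_prodMk_right (w.u t) b))
    lam t (w.v t) ξ ζ
  refine h1.symm.trans ?_
  set L : StrongDual ℝ (E m) := ∑ k : Fin m,
    lam.p t (P.f k.succ (w.x t, w.u t)) • EuclideanSpace.proj k with hL
  have h2 : (fun b => P.H lam (w.x t) (w.u t) b t) =
      fun b => L b + lam.p t (P.f 0 (w.x t, w.u t)) := by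
    ext b
    simp [H, F, hL, Fin.sum_univ_succ, sum_apply, add_comm, mul_comm]
  have h3 : fderiv ℝ (fun b => P.H lam (w.x t) (w.u t) b t) = fun _ => L := by
    rw [h2]
    ext1 b
    exact (L.hasFDerivAt.add_const _).fderiv
  change fderiv ℝ (fderiv ℝ (fun b => P.H lam (w.x t) (w.u t) b t)) (w.v t) ξ ζ = 0
  rw [h3]
  simp

theorem Regular.hessUV_eq_fromBlocks (h : P.Regular) (lam : Triple n dφ dη) (t : ℝ) :
    P.hessUV w lam t = Matrix.fromBlocks (P.Huu w lam t) (P.Hvu w lam t).transpose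
      (P.Hvu w lam t) 0 := by
  ext i j
  rw [h.hessUV_apply]
  rcases i with i | i <;> rcases j with j | j
  · simp [h.Huu_apply]
  · simp [h.Hvu_apply, h.hessForm_comm lam t (e i, 0)]
  · simp [h.Hvu_apply]
  · simp [h.hessForm_snd_snd]

theorem Regular.posSemidef_hessUV (h : P.Regular) {lam : Triple n dφ dη} {t : ℝ}
    (hpos : ∀ ξ, 0 ≤ P.hessForm w lam t ξ ξ) : (P.hessUV w lam t).PosSemidef := by
  refine Matrix.PosSemidef.of_dotProduct_mulVec_nonneg ?_ fun c => ?_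
  · ext i j
    simp only [Matrix.conjTranspose_apply, star_trivial, h.hessUV_apply]
    exact h.hessForm_comm lam t _ _
  · have := hpos (∑ i, c i • Sum.elim (fun i => (e i, 0)) (fun k => (0, e k)) i)
    rw [hessForm_sum] at this
    simpa only [dotProduct, Matrix.mulVec, star_trivial, h.hessUV_apply] using this

/-- On `(eᵢ, s eₖ)` the form equals `a + 2 s b`, because its `vv` part vanishes. An affine function
of `s` bounded below has zero slope. -/
theorem Regular.Hvu_eq_zero (h : P.Regular) {lam : Triple n dφ dη} {t : ℝ}
    (hpos : ∀ ξ, 0 ≤ P.hessForm w lam t ξ ξ) : P.Hvu w lam t = 0 := by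
  ext k i
  rw [h.Hvu_apply, Matrix.zero_apply]
  set a := P.hessForm w lam t (e i, 0) (e i, 0) with ha
  set b := P.hessForm w lam t (0, e k) (e i, 0) with hb
  have key : ∀ s : ℝ, 0 ≤ a + 2 * s * b := by
    intro s
    have := hpos (∑ j, ![1, s] j • ![((e i, 0) : E l × E m), (0, e k)] j)
    rw [hessForm_sum] at this
    simp only [Fin.sum_univ_two, Matrix.cons_val_zero, Matrix.cons_val_one,
      h.hessForm_snd_snd, h.hessForm_comm lam t (e i, 0) (0, e k), ← ha, ← hb] at this
    linarith
  by_contra hb0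
  have := key (-(a + 1) / (2 * b))
  have h2 : a + 2 * (-(a + 1) / (2 * b)) * b = -1 := by
    field_simp
    ring
  linarith

end Problem

end PartiallyAffine

theorem mainTheorem7 {n l m dφ dη : ℕ} (P : PartiallyAffine.Problem n l m dφ dη) (hT : 0 < P.T)
    (hreg : P.Regular) (w : PartiallyAffine.StateControl n l m)
    (hact : ∀ i : Fin dφ, P.φ i.succ (P.endpoints w) = 0)
    (hmin : P.IsWeakMin w) (lam : PartiallyAffine.Triple n dφ dη)
    (hlam : P.IsUniqueMultiplier w lam) :
    ∀ᵐ t ∂MeasureTheory.volume.restrict (Set.Icc 0 P.T),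
      P.hessUV w lam t =
          Matrix.fromBlocks (P.Huu w lam t) (P.Hvu w lam t).transpose (P.Hvu w lam t) 0 ∧
        (P.hessUV w lam t).PosSemidef ∧
        (P.Huu w lam t).PosSemidef ∧ P.Hvu w lam t = 0 := by
  filter_upwards [hmin.ae_forall_nonneg hT hreg hact hlam] with t hpos
  have hblocks := hreg.hessUV_eq_fromBlocks (w := w) lam t
  have hpsd := hreg.posSemidef_hessUV hpos
  refine ⟨hblocks, hpsd, ?_, hreg.Hvu_eq_zero hpos⟩
  -- `H_uu` is a principal submatrix of the Hessian.
  have := hpsd.submatrix Sum.inl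
  rw [hblocks] at this
  exact this
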